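/- Let $T>0$ and let $\Gamma(t)\subset\mathbb{R}^3$, $t\in[0,T]$, be a two-dimensional closed (compact, without boundary), connected, smooth surface that moves smoothly in time, oriented by its outward unit normal field $\nu(\cdot,t)$ (or by the opposite unit normal field), with normal velocity $V_\Gamma^N(\cdot,t)$ in the direction of $\nu$. Put $S_T=\bigcup_{t\in(0,T)}\Gamma(t)\times\{t\}$ and $P_\Gamma=I_3-\nu\otimes\nu$. For a function $f$ on $\Gamma(t)$ let $\nabla_\Gamma f=P_\Gamma\nabla\tilde f=(\partial_1^{tan}f,\partial_2^{tan}f,\partial_3^{tan}f)$, where $\tilde f$ is any extension of $f$ to a neighborhood of $\Gamma(t)$; for a vector field $G$ let $\mathrm{div}_\Gamma G=\sum_{i=1}^3\partial_i^{tan}G_i$; let $H=-\mathrm{div}_\Gamma\nu$; and for a vector field $f$ on $S_T$ let $\partial^\bullet_v f=\partial_t\tilde f+(v\cdot\nabla)\tilde f$ on $S_T$ be the material derivative along $v$, where $\tilde f$ is any extension of $f$ to a neighborhood of $S_T$. Let $v\colon S_T\to\mathbb{R}^3$ and $q\colon S_T\to\mathbb{R}$ be continuously differentiable and $q^1\colon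 S_T\to\mathbb{R}$ be a function such that $v\cdot\nu=V_\Gamma^N$ on $S_T$ and $$\partial^\bullet_v v+\nabla_\Gamma q+q^1\nu=0,\qquad \mathrm{div}_\Gamma v=0\qquad\text{on } S_T.$$ Then for every $t\in(0,T)$ the functions $|v|^2/2$ and $(qH-q^1)V_\Gamma^N$ are integrable on $\Gamma(t)$ with respect to the two-dimensional Hausdorff measure $\mathcal{H}^2$, the function $t\mapsto\int_{\Gamma(t)}\frac{|v|^2}{2}\,d\mathcal{H}^2$ is differentiable at $t$, and $$\frac{d}{dt}\int_{\Gamma(t)}\frac{|v|^2}{2}\,d\mathcal{H}^2=\int_{\Gamma(t)}(qH-q^1)V_\Gamma^N\,d\mathcal{H}^2.$$ -/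

import Mathlib

open MeasureTheory Set Filter Topology
open scoped ContDiff

/-- Three-dimensional Euclidean space. -/
abbrev E3 : Type := EuclideanSpace ℝ (Fin 3)

/-- The space-time set `⋃ t ∈ I, {t} × Γ(t)`. -/
def spaceTime (I : Set ℝ) (Γ : ℝ → Set E3) : Set (ℝ × E3) :=
  {p | p.1 ∈ I ∧ p.2 ∈ Γ p.1}

/-- `Γ(t)`, `t ∈ [0,T]`, is a two-dimensional closed, connected surface in `ℝ³`, oriented by the
unit normal field `ν(t, ·)`, which is smooth at each time and moves smoothly in time: near each of
its points, the space-time set of `Γ` is the zero set of a smooth function `φ(t, x)` whose spatial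
gradient on the surface is a positive multiple of `ν`. (So `ν = ∇φ / |∇φ|` is a smooth unit normal
field. The outward one is one of the two possible choices.) -/
structure IsMovingClosedSurface (T : ℝ) (Γ : ℝ → Set E3) (ν : ℝ → E3 → E3) : Prop where
  isCompact : IsCompact (spaceTime (Icc 0 T) Γ)
  isConnected : ∀ t ∈ Icc 0 T, IsConnected (Γ t)
  norm_normal : ∀ t ∈ Icc 0 T, ∀ y ∈ Γ t, ‖ν t y‖ = 1
  smooth : ∀ t₀ ∈ Icc 0 T, ∀ y₀ ∈ Γ t₀, ∃ (U : Set (ℝ × E3)) (φ : ℝ × E3 → ℝ),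
    IsOpen U ∧ (t₀, y₀) ∈ U ∧ ContDiffOn ℝ ∞ φ U ∧
    ∀ t x, (t, x) ∈ U → t ∈ Icc 0 T →
      ((x ∈ Γ t ↔ φ (t, x) = 0) ∧
        (x ∈ Γ t → ∃ c : ℝ, 0 < c ∧ gradient (fun z => φ (t, z)) x = c • ν t x))

/-- `V` is the (scalar) normal velocity at `y ∈ Γ(t)` in the direction of `ν`: the component along
`ν` of the velocity of a point that moves with the surface and is at `y` at time `t`. (On a smoothly
moving surface every such point gives the same value, `-∂ₜφ / |∇φ|`.) -/
def IsNormalVelocityAt (Γ : ℝ → Set E3) (ν : ℝ → E3 → E3) (t : ℝ) (y : E3) (V : ℝ) : Prop :=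
  ∃ (γ : ℝ → E3) (w : E3), γ t = y ∧ (∀ᶠ s in 𝓝 t, γ s ∈ Γ s) ∧ HasDerivAt γ w t ∧
    inner ℝ w (ν t y) = V

/-- The orthogonal projection `P = I - n ⊗ n` (for a unit vector `n`). -/
noncomputable def tanProj (n w : E3) : E3 := w - inner ℝ n w • n

/-- The tangential gradient `∇_Γ f = P_Γ ∇f̃` on a surface `Γ` with unit normal field `n`. Here
`gradientWithin f Γ` is the gradient of a differentiable extension `f̃` of `f`; the tangential part
does not depend on the extension. -/
noncomputable def surfGrad (Γ : Set E3) (n : E3 → E3) (f : E3 → ℝ) (y : E3) : E3 :=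
  tanProj (n y) (gradientWithin f Γ y)

/-- The surface divergence `div_Γ G = ∑ i, ∂ᵢᵗᵃⁿ Gᵢ`, where `∂ᵢᵗᵃⁿ f` is the `i`-th component of
`∇_Γ f`. -/
noncomputable def surfDiv (Γ : Set E3) (n : E3 → E3) (G : E3 → E3) (y : E3) : ℝ :=
  ∑ i : Fin 3, surfGrad Γ n (fun z => G z i) y i

/-- (Twice) the mean curvature `H = -div_Γ n`. -/
noncomputable def meanCurv (Γ : Set E3) (n : E3 → E3) (y : E3) : ℝ :=
  -surfDiv Γ n n y

/-- The material derivative `∂ᵛ• f = ∂ₜ f̃ + (v · ∇) f̃` at `(t, y)` of a field `f` on the space-time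
surface over `(0,T)`, for a differentiable extension `f̃` of `f` to space-time, that is, the
derivative of `f` within this surface in the direction `(1, v)`. It does not depend on the extension
because `(1, v)` is tangent to the surface when `v · ν` is the normal velocity. -/
noncomputable def materialDeriv (T : ℝ) (Γ : ℝ → Set E3) (v f : ℝ → E3 → E3) (t : ℝ) (y : E3) :
    E3 :=
  fderivWithin ℝ (Function.uncurry f) (spaceTime (Ioo 0 T) Γ) (t, y) (1, v t y)

/-! ### Hausdorff measure and the area formula -/

open scoped ENNReal NNReal

/-! The core is the transport theorem d/dt ∫_Γ F = ∫_Γ (∂•_w F + F div_Γ w), valid for every C¹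
field w whose normal component is the normal velocity V. For F = |v|²/2 and w = v, the two equations
turn the right side into -∫ (v·∇_Γ q + q¹ V). The pressure term needs no divergence theorem on Γ:
the transport theorem is applied to F = q twice, with w = v and with w = Vν. Both compute the same
derivative, so the right sides agree. Their difference is ∫ (v·∇_Γ q + q V H), because ∂•_v - ∂•_w
differentiates along the tangential part of v and div_Γ(Vν) = -VH.

The transport theorem is local. A partition of unity in space-time reduces it to cut-off fields
where Γ is a moving graph of h, and the area formula gives planar integrals with density W = √(1 +
|∇h|²). If u is the planar part of w, then W div_Γ w = (∂ₜ + u·∇)W + W div u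
(`IsGraphChart.surfDiv_eq_coord`). Hence the integrand becomes ∂ₜG + div(Gu), where G is W times the
cut-off field. The divergence integrates to zero, and ∂ₜ passes under the integral. -/

theorem euclideanHausdorffMeasure_image_le_of_edist_le {α X Y : Type*} [EMetricSpace X]
    [MeasurableSpace X] [BorelSpace X] [EMetricSpace Y] [MeasurableSpace Y] [BorelSpace Y]
    {f : α → X} {g : α → Y} {A : Set α} {K : ℝ≥0} (d : ℕ)
    (h : ∀ a ∈ A, ∀ b ∈ A, edist (f a) (f b) ≤ K * edist (g a) (g b)) :
    μHE[d] (f '' A) ≤ (K : ℝ≥0∞) ^ d * μHE[d] (g '' A) := by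
  rcases A.eq_empty_or_nonempty with rfl | ⟨a₀, -⟩
  · simp
  have : Nonempty α := ⟨a₀⟩
  -- On `A`, equal values of `g` force equal values of `f`, so `f` factors through `g` by the
  -- `K`-Lipschitz map `f ∘ s`.
  set s := Function.invFunOn g A
  have hs : ∀ a ∈ A, s (g a) ∈ A ∧ g (s (g a)) = g a := fun a ha =>
    ⟨Function.invFunOn_mem ⟨a, ha, rfl⟩, Function.invFunOn_eq ⟨a, ha, rfl⟩⟩
  have hfs : ∀ a ∈ A, f (s (g a)) = f a := by
    intro a ha
    have := h _ (hs a ha).1 a ha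
    rw [(hs a ha).2, edist_self, mul_zero] at this
    exact edist_le_zero.1 this
  have himg : f '' A = (f ∘ s) '' (g '' A) := by
    rw [image_image]
    exact image_congr fun a ha => (hfs a ha).symm
  have hL : LipschitzOnWith K (f ∘ s) (g '' A) := by
    rintro _ ⟨a, ha, rfl⟩ _ ⟨b, hb, rfl⟩
    simp only [Function.comp, hfs a ha, hfs b hb]
    exact h a ha b hb
  rw [himg]
  have := hL.hausdorffMeasure_image_le (d := d) (by positivity)
  simp only [Measure.euclideanHausdorffMeasure_def, Measure.smul_apply,
    ENNReal.smul_def, smul_eq_mul]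
  rw [mul_left_comm]
  gcongr
  simpa using this

/-- By the Lindelöf property countably many of the sets `O` suffice; they cut `A` into disjoint
measurable pieces, and the inequality is summed. -/
theorem measure_le_of_locally_le {X : Type*} [TopologicalSpace X] [SecondCountableTopology X]
    [MeasurableSpace X] [OpensMeasurableSpace X] {μ ν : Measure X} {Ω : Set X}
    (h : ∀ x ∈ Ω, ∃ O : Set X, IsOpen O ∧ x ∈ O ∧
      ∀ A ⊆ O ∩ Ω, MeasurableSet A → μ A ≤ ν A)
    {A : Set X} (hA : A ⊆ Ω) (hAm : MeasurableSet A) : μ A ≤ ν A := by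
  choose! O hO hxO hle using h
  obtain ⟨t, htΩ, htc, hcov⟩ := TopologicalSpace.countable_cover_nhdsWithin
    (f := O) (s := Ω) fun x hx => mem_nhdsWithin_of_mem_nhds ((hO x hx).mem_nhds (hxO x hx))
  rcases t.eq_empty_or_nonempty with rfl | hne
  · have : A = ∅ := by
      apply subset_empty_iff.1
      simpa using hA.trans hcov
    simp [this]
  obtain ⟨u, rfl⟩ := htc.exists_eq_range hne
  set B : ℕ → Set X := fun i => A ∩ O (u i)
  have hu : ∀ i, u i ∈ Ω := fun i => htΩ (mem_range_self i)
  have hBm : ∀ i, MeasurableSet (B i) := fun i => hAm.inter (hO _ (hu i)).measurableSet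
  have hAB : A = ⋃ i, disjointed B i := by
    rw [iUnion_disjointed, ← inter_iUnion]
    refine (inter_eq_left.2 ?_).symm
    refine (hA.trans hcov).trans ?_
    simp
  have hdm : ∀ i, MeasurableSet (disjointed B i) := fun i => MeasurableSet.disjointed hBm i
  rw [hAB, measure_iUnion (disjoint_disjointed B) hdm, measure_iUnion (disjoint_disjointed B) hdm]
  refine ENNReal.tsum_le_tsum fun i => hle _ (hu i) _ ?_ (hdm i)
  exact (disjointed_subset B i).trans fun x hx => ⟨hx.2, hA hx.1⟩

section area

variable {U V : Type*} [NormedAddCommGroup U] [InnerProductSpace ℝ U] [FiniteDimensional ℝ U]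
  [MeasurableSpace U] [BorelSpace U] [NormedAddCommGroup V] [InnerProductSpace ℝ V]
  [MeasurableSpace V] [BorelSpace V]

-- Strict differentiability makes distances under `ψ` and under `L` comparable up to the factor `c`
-- near `y`, and a linear map scales measure by exactly `normDet`.
open Module in
theorem HasStrictFDerivAt.exists_hausdorffMeasure_image_approx {ψ : U → V} {L : U →L[ℝ] V} {y : U}
    (hψ : HasStrictFDerivAt ψ L y) (hL : Function.Injective L) {c : ℝ≥0} (hc : 1 < c) :
    ∃ O : Set U, IsOpen O ∧ y ∈ O ∧ ∀ A ⊆ O,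
      μHE[finrank ℝ U] (ψ '' A) ≤
        (c : ℝ≥0∞) ^ finrank ℝ U * (ENNReal.ofReal L.normDet * volume A) ∧
      ENNReal.ofReal L.normDet * volume A ≤
        (c : ℝ≥0∞) ^ finrank ℝ U * μHE[finrank ℝ U] (ψ '' A) := by
  obtain ⟨κ, hκ, hanti⟩ := LinearMap.exists_antilipschitzWith (L : U →ₗ[ℝ] V)
    (LinearMap.ker_eq_bot.2 hL)
  have hκ' : (0 : ℝ) < κ := hκ
  have hc' : (1 : ℝ) < c := hc
  -- Since `‖a‖ ≤ κ * ‖L a‖`, the linearization error is at most `(1 - c⁻¹) * ‖L (a - b)‖`. So `‖ψ a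
  -- - ψ b‖` lies between `c⁻¹` and `2 - c⁻¹ ≤ c` times `‖L (a - b)‖`.
  set δ : ℝ := (1 - (c : ℝ)⁻¹) / κ with hδ
  have hδ0 : 0 < δ := by
    have : (c : ℝ)⁻¹ < 1 := inv_lt_one_of_one_lt₀ hc'
    apply div_pos <;> linarith
  have hev := hψ.isLittleO.def hδ0
  rw [nhds_prod_eq] at hev
  obtain ⟨O, hO, hyO⟩ := (eventually_prod_self_iff
    (r := fun a b : U => ‖ψ a - ψ b - L (a - b)‖ ≤ δ * ‖a - b‖)).1 hev
  obtain ⟨O', hO'O, hO'o, hyO'⟩ := mem_nhds_iff.1 hO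
  refine ⟨O', hO'o, hyO', fun A hA => ?_⟩
  have hLb : ∀ a : U, ‖a‖ ≤ κ * ‖L a‖ := by
    intro a
    simpa using hanti.le_mul_dist a 0
  have key : ∀ a ∈ A, ∀ b ∈ A, ‖ψ a - ψ b - L (a - b)‖ ≤ (1 - (c : ℝ)⁻¹) * ‖L (a - b)‖ := by
    intro a ha b hb
    have h1 := hyO a (hO'O (hA ha)) b (hO'O (hA hb))
    refine h1.trans ?_
    calc δ * ‖a - b‖ ≤ δ * (κ * ‖L (a - b)‖) := by gcongr; exact hLb _
      _ = _ := by rw [hδ]; field_simp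
  have hci : (c : ℝ) * (c : ℝ)⁻¹ = 1 := mul_inv_cancel₀ (by positivity)
  have hed : ∀ (p q r s : V), ‖p - q‖ ≤ c * ‖r - s‖ → edist p q ≤ c * edist r s := by
    intro p q r s h
    rw [edist_nndist, edist_nndist, ← ENNReal.coe_mul, ENNReal.coe_le_coe]
    rw [← NNReal.coe_le_coe]
    simpa [dist_eq_norm] using h
  have hlin : ENNReal.ofReal L.normDet * volume A = μHE[finrank ℝ U] (L '' A) :=
    ((L : U →ₗ[ℝ] V).euclideanHausdorffMeasure_image_eq_normDet_mul_volume A).symm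
  rw [hlin]
  have hnn : ∀ a b, 0 ≤ ‖L (a - b)‖ := fun a b => norm_nonneg _
  constructor
  · refine euclideanHausdorffMeasure_image_le_of_edist_le _ fun a ha b hb => hed _ _ _ _ ?_
    rw [← map_sub]
    have h1 := key a ha b hb
    have h2 := norm_le_insert' (ψ a - ψ b) (L (a - b))
    have h3 : 2 - (c : ℝ)⁻¹ ≤ c := by
      nlinarith [sq_nonneg ((c : ℝ) - 1), inv_pos.2 (zero_lt_one.trans hc')]
    nlinarith [hnn a b]
  · refine euclideanHausdorffMeasure_image_le_of_edist_le _ fun a ha b hb => hed _ _ _ _ ?_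
    rw [← map_sub]
    have h1 := key a ha b hb
    have h2 := norm_le_insert (ψ a - ψ b) (L (a - b))
    have h4 : (c : ℝ)⁻¹ * ‖L (a - b)‖ ≤ ‖ψ a - ψ b‖ := by linarith
    calc ‖L (a - b)‖ = c * ((c : ℝ)⁻¹ * ‖L (a - b)‖) := by rw [← mul_assoc, hci, one_mul]
      _ ≤ _ := by gcongr

open Module in
/-- The **area formula** for an injective `C¹` immersion `ψ` on an open set `Ω`, in terms of a
continuous left inverse `π`. -/
theorem map_restrict_euclideanHausdorffMeasure_image {ψ : U → V} {ψ' : U → U →L[ℝ] V} {π : V → U}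
    {J : U → ℝ} {Ω : Set U} (hΩ : IsOpen Ω) (hψ : ∀ y ∈ Ω, HasStrictFDerivAt ψ (ψ' y) y)
    (hinj : ∀ y ∈ Ω, Function.Injective (ψ' y)) (hJ : ∀ y ∈ Ω, (ψ' y).normDet = J y)
    (hJc : ContinuousOn J Ω) (hπ : Continuous π) (hπψ : ∀ y ∈ Ω, π (ψ y) = y) :
    (μHE[finrank ℝ U].restrict (ψ '' Ω)).map π =
      (volume.restrict Ω).withDensity fun y => ENNReal.ofReal (J y) := by
  set d := finrank ℝ U
  set m := (μHE[d].restrict (ψ '' Ω)).map π with hm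
  set n := (volume.restrict Ω).withDensity fun y => ENNReal.ofReal (J y) with hn
  have hmA : ∀ A ⊆ Ω, MeasurableSet A → m A = μHE[d] (ψ '' A) := by
    intro A hA hAm
    rw [hm, Measure.map_apply hπ.measurable hAm, Measure.restrict_apply (hπ.measurable hAm)]
    congr 1
    ext x
    constructor
    · rintro ⟨hx, y, hy, rfl⟩
      rw [mem_preimage, hπψ y hy] at hx
      exact ⟨y, hx, rfl⟩
    · rintro ⟨y, hy, rfl⟩
      exact ⟨by rw [mem_preimage, hπψ y (hA hy)]; exact hy, y, hA hy, rfl⟩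
  have hnA : ∀ A ⊆ Ω, MeasurableSet A → n A = ∫⁻ y in A, ENNReal.ofReal (J y) := by
    intro A hA hAm
    rw [hn, withDensity_apply _ hAm, Measure.restrict_restrict hAm, inter_eq_left.2 hA]
  -- The power `d` comes from comparing `ψ` with its derivative at `y`, one more factor `c` from the
  -- variation of `J` near `y`. Equality results as `c` decreases to 1.
  have hloc : ∀ c : ℝ≥0, 1 < c → ∀ y ∈ Ω, ∃ O : Set U, IsOpen O ∧ y ∈ O ∧
      ∀ A ⊆ O ∩ Ω, MeasurableSet A →
        m A ≤ (c : ℝ≥0∞) ^ (d + 1) * n A ∧ n A ≤ (c : ℝ≥0∞) ^ (d + 1) * m A := by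
    intro c hc y hy
    have hc' : (1 : ℝ) < c := hc
    have hc0 : (0 : ℝ) < c := by linarith
    obtain ⟨O, hO, hyO, hOA⟩ := (hψ y hy).exists_hausdorffMeasure_image_approx (hinj y hy) hc
    have hJ0 : 0 < J y := by
      rw [← hJ y hy]
      refine lt_of_le_of_ne (LinearMap.normDet_nonneg _) (Ne.symm ?_)
      exact ((LinearMap.normDet_ne_zero_tfae (ψ' y : U →ₗ[ℝ] V)).out 0 4).2 (hinj y hy)
    have hcont := (hJc.continuousAt (hΩ.mem_nhds hy))
    have h1 : ∀ᶠ z in 𝓝 y, J z < c * J y := hcont.eventually_lt_const (by nlinarith)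
    have h2 : ∀ᶠ z in 𝓝 y, (c : ℝ)⁻¹ * J y < J z := hcont.eventually_const_lt (by
      have : (c : ℝ)⁻¹ < 1 := inv_lt_one_of_one_lt₀ hc'
      nlinarith)
    obtain ⟨O₂, hO₂, hO₂o, hyO₂⟩ := mem_nhds_iff.1 (h1.and h2)
    refine ⟨O ∩ O₂, hO.inter hO₂o, ⟨hyO, hyO₂⟩, fun A hA hAm => ?_⟩
    have hAΩ : A ⊆ Ω := fun x hx => (hA hx).2
    rw [hmA A hAΩ hAm, hnA A hAΩ hAm]
    obtain ⟨h3, h4⟩ := hOA A fun x hx => (hA hx).1.1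
    rw [hJ y hy] at h3 h4
    have h5 : ENNReal.ofReal (J y) * volume A ≤ c * ∫⁻ y in A, ENNReal.ofReal (J y) := by
      rw [← setLIntegral_const, ← lintegral_const_mul' _ _ ENNReal.coe_ne_top]
      refine setLIntegral_mono' hAm fun z hz => ?_
      rw [← ENNReal.ofReal_coe_nnreal, ← ENNReal.ofReal_mul hc0.le]
      refine ENNReal.ofReal_le_ofReal ?_
      have := (hO₂ (hA hz).1.2).2
      rw [inv_mul_lt_iff₀ hc0] at this
      exact this.le
    have h6 : ∫⁻ y in A, ENNReal.ofReal (J y) ≤ c * (ENNReal.ofReal (J y) * volume A) := by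
      rw [← setLIntegral_const, ← lintegral_const_mul' _ _ ENNReal.coe_ne_top]
      refine setLIntegral_mono' hAm fun z hz => ?_
      rw [← ENNReal.ofReal_coe_nnreal, ← ENNReal.ofReal_mul hc0.le]
      exact ENNReal.ofReal_le_ofReal (hO₂ (hA hz).1.2).1.le
    constructor
    · rw [pow_succ, mul_assoc]
      exact h3.trans (by gcongr)
    · rw [pow_succ', mul_assoc]
      exact h6.trans (by gcongr)
  have hlim : ∀ (a : ℝ≥0∞), Tendsto (fun c : ℝ≥0 => (c : ℝ≥0∞) ^ (d + 1) * a) (𝓝[>] 1) (𝓝 a) := by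
    intro a
    have : Tendsto (fun c : ℝ≥0 => (c : ℝ≥0∞) ^ (d + 1)) (𝓝[>] 1) (𝓝 1) := by
      have h : Continuous (fun c : ℝ≥0 => (c : ℝ≥0∞) ^ (d + 1)) := by
        fun_prop
      have := (h.tendsto 1).mono_left (nhdsWithin_le_nhds (s := Ioi 1))
      simpa using this
    simpa using ENNReal.Tendsto.mul_const (b := a) this (Or.inl one_ne_zero)
  have hle : ∀ A ⊆ Ω, MeasurableSet A → m A = n A := by
    intro A hA hAm
    apply le_antisymm
    · refine ge_of_tendsto (hlim (n A)) ?_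
      filter_upwards [self_mem_nhdsWithin] with c hc
      refine measure_le_of_locally_le (ν := (c : ℝ≥0∞) ^ (d + 1) • n) (fun y hy => ?_) hA hAm
      obtain ⟨O, hO, hyO, h⟩ := hloc c hc y hy
      exact ⟨O, hO, hyO, fun A hA hAm => (h A hA hAm).1⟩
    · refine ge_of_tendsto (hlim (m A)) ?_
      filter_upwards [self_mem_nhdsWithin] with c hc
      refine measure_le_of_locally_le (ν := (c : ℝ≥0∞) ^ (d + 1) • m) (fun y hy => ?_) hA hAm
      obtain ⟨O, hO, hyO, h⟩ := hloc c hc y hy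
      exact ⟨O, hO, hyO, fun A hA hAm => (h A hA hAm).2⟩
  have hmr : ∀ A, MeasurableSet A → m A = m (A ∩ Ω) := by
    intro A hAm
    rw [hm, Measure.map_apply hπ.measurable hAm,
      Measure.map_apply hπ.measurable (hAm.inter hΩ.measurableSet),
      Measure.restrict_apply (hπ.measurable hAm),
      Measure.restrict_apply (hπ.measurable (hAm.inter hΩ.measurableSet))]
    congr 1
    ext x
    constructor
    · rintro ⟨hx, y, hy, rfl⟩
      exact ⟨⟨hx, by rw [hπψ y hy]; exact hy⟩, y, hy, rfl⟩
    · rintro ⟨hx, h⟩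
      exact ⟨hx.1, h⟩
  have hnr : ∀ A, MeasurableSet A → n A = n (A ∩ Ω) := by
    intro A hAm
    rw [hn, withDensity_apply _ hAm, withDensity_apply _ (hAm.inter hΩ.measurableSet),
      Measure.restrict_restrict hAm, Measure.restrict_restrict (hAm.inter hΩ.measurableSet)]
    simp [inter_assoc]
  ext A hAm
  rw [hmr A hAm, hnr A hAm]
  exact hle _ inter_subset_right (hAm.inter hΩ.measurableSet)

end area

/-! ### Graphs over a plane in an orthonormal frame -/

/-- The Euclidean plane. -/
abbrev E2 : Type := EuclideanSpace ℝ (Fin 2)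

/-- The embedding of the plane as the span of the first two vectors of a frame. -/
noncomputable def planeEmb (e : OrthonormalBasis (Fin 3) ℝ E3) : E2 →L[ℝ] E3 :=
  (EuclideanSpace.proj (0 : Fin 2) : E2 →L[ℝ] ℝ).smulRight (e 0) +
    (EuclideanSpace.proj (1 : Fin 2) : E2 →L[ℝ] ℝ).smulRight (e 1)

/-- The first two coordinates with respect to a frame. -/
noncomputable def planeProj (e : OrthonormalBasis (Fin 3) ℝ E3) : E3 →L[ℝ] E2 :=
  ((PiLp.continuousLinearEquiv 2 ℝ (fun _ : Fin 2 => ℝ)).symm : (Fin 2 → ℝ) →L[ℝ] E2).comp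
    (ContinuousLinearMap.pi fun k => innerSL ℝ (e k.castSucc))

/-- The parametrization of the graphs of `h (s, ·)` over the plane of the first two vectors of a
frame. -/
noncomputable def graphMap (e : OrthonormalBasis (Fin 3) ℝ E3) (h : ℝ × E2 → ℝ) (p : ℝ × E2) : E3 :=
  planeEmb e p.2 + h p • e 2

/-- The `k`-th unit vector of the plane as a direction in `ℝ × E2`. -/
noncomputable def planeDir (k : Fin 2) : ℝ × E2 := (0, EuclideanSpace.single k 1)

/-- The spatial partial derivatives of `h`. -/
noncomputable def slope2 (h : ℝ × E2 → ℝ) (k : Fin 2) (p : ℝ × E2) : ℝ := fderiv ℝ h p (planeDir k)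

/-- The unnormalized normal to the graph of `h`. -/
noncomputable def graphNormal (e : OrthonormalBasis (Fin 3) ℝ E3) (h : ℝ × E2 → ℝ) (p : ℝ × E2) :
    E3 :=
  e 2 - slope2 h 0 p • e 0 - slope2 h 1 p • e 1

/-- The area density of the graph of `h`. -/
noncomputable def areaDensity (h : ℝ × E2 → ℝ) (p : ℝ × E2) : ℝ :=
  √(1 + slope2 h 0 p ^ 2 + slope2 h 1 p ^ 2)

section frame

variable (e : OrthonormalBasis (Fin 3) ℝ E3)

theorem planeEmb_apply (y : E2) : planeEmb e y = y 0 • e 0 + y 1 • e 1 := rfl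

theorem planeProj_apply (x : E3) (k : Fin 2) : planeProj e x k = inner ℝ (e k.castSucc) x := rfl

theorem inner_frame (i j : Fin 3) : inner ℝ (e i) (e j) = if i = j then (1 : ℝ) else 0 :=
  e.inner_eq_ite i j

theorem planeEmb_planeProj_add (x : E3) :
    planeEmb e (planeProj e x) + (inner ℝ (e 2) x : ℝ) • e 2 = x := by
  conv_rhs => rw [← e.sum_repr' x]
  simp [Fin.sum_univ_three, planeEmb_apply, planeProj_apply]

theorem planeProj_planeEmb_add (y : E2) (a : ℝ) : planeProj e (planeEmb e y + a • e 2) = y := by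
  ext k
  fin_cases k <;>
    simp [planeEmb_apply, planeProj_apply]

theorem inner_two_planeEmb_add (y : E2) (a : ℝ) : inner ℝ (e 2) (planeEmb e y + a • e 2) = a := by
  simp [planeEmb_apply, inner_add_right, inner_smul_right]

theorem planeProj_graphMap (h : ℝ × E2 → ℝ) (p : ℝ × E2) : planeProj e (graphMap e h p) = p.2 :=
  planeProj_planeEmb_add e _ _

theorem E2.eq_sum (η : E2) : η = η 0 • EuclideanSpace.single 0 1 + η 1 • EuclideanSpace.single 1 1 := by
  ext k
  fin_cases k <;> simp

theorem planeDir_decomp (η : E2) : ((0 : ℝ), η) = η 0 • planeDir 0 + η 1 • planeDir 1 := by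
  conv_lhs => rw [E2.eq_sum η]
  simp [planeDir]

/-- A vector killed by the first two components is a spatial multiple of `e 2`, which `φ'` detects;
the dimensions agree. -/
theorem exists_equiv_prod_planeProj {φ' : ℝ × E3 →L[ℝ] ℝ} (h : φ' (0, e 2) ≠ 0) :
    ∃ f' : (ℝ × E3) ≃L[ℝ] ℝ × E2 × ℝ, (f' : ℝ × E3 →L[ℝ] ℝ × E2 × ℝ) =
      (ContinuousLinearMap.fst ℝ ℝ E3).prod
        (((planeProj e).comp (ContinuousLinearMap.snd ℝ ℝ E3)).prod φ') := by
  set A := (ContinuousLinearMap.fst ℝ ℝ E3).prod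
        (((planeProj e).comp (ContinuousLinearMap.snd ℝ ℝ E3)).prod φ') with hA
  have hinj : Function.Injective (A : ℝ × E3 →ₗ[ℝ] ℝ × E2 × ℝ) := by
    rw [injective_iff_map_eq_zero]
    rintro ⟨σ, ξ⟩ hz
    have hz' : (σ, planeProj e ξ, φ' (σ, ξ)) = 0 := hz
    simp only [Prod.mk_eq_zero] at hz'
    obtain ⟨rfl, h1, h2⟩ := hz'
    have h3 := planeEmb_planeProj_add e ξ
    rw [h1, map_zero, zero_add] at h3
    rw [← h3] at h2
    have h4 : φ' (0, (inner ℝ (e 2) ξ : ℝ) • e 2) = inner ℝ (e 2) ξ * φ' (0, e 2) := by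
      rw [← smul_eq_mul, ← map_smul φ']
      simp
    rw [h4, mul_eq_zero, or_iff_left h] at h2
    rw [h2, zero_smul] at h3
    simp [← h3]
  refine ⟨(LinearEquiv.ofInjectiveOfFinrankEq (A : ℝ × E3 →ₗ[ℝ] ℝ × E2 × ℝ) hinj
    (by simp)).toContinuousLinearEquiv, ?_⟩
  ext x <;> rfl

end frame

/-! ### Local graph charts of the moving surface -/

/-- `h` describes the moving surface `Γ` in the space-time region `N` as a family of graphs. -/
structure IsGraphChart (T : ℝ) (Γ : ℝ → Set E3) (ν : ℝ → E3 → E3)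
    (e : OrthonormalBasis (Fin 3) ℝ E3) (N : Set (ℝ × E3)) (D : Set (ℝ × E2)) (h : ℝ × E2 → ℝ) :
    Prop where
  isOpen_source : IsOpen N
  isOpen_target : IsOpen D
  fst_mem : ∀ p ∈ N, p.1 ∈ Ioo 0 T
  contDiffOn : ContDiffOn ℝ ∞ h D
  map_mem : ∀ p ∈ D, (p.1, graphMap e h p) ∈ N ∧ graphMap e h p ∈ Γ p.1
  proj_mem : ∀ s x, (s, x) ∈ N → x ∈ Γ s →
    (s, planeProj e x) ∈ D ∧ graphMap e h (s, planeProj e x) = x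
  normal : ∀ p ∈ D, ∃ c : ℝ, ν p.1 (graphMap e h p) = c • graphNormal e h p

theorem inner_gradient_eq {φ : ℝ × E3 → ℝ} {t : ℝ} {x : E3} (h : DifferentiableAt ℝ φ (t, x))
    (ξ : E3) : inner ℝ (gradient (fun z => φ (t, z)) x) ξ = fderiv ℝ φ (t, x) (0, ξ) := by
  have h1 : HasFDerivAt (fun z => φ (t, z))
      ((fderiv ℝ φ (t, x)).comp (ContinuousLinearMap.inr ℝ ℝ E3)) x :=
    h.hasFDerivAt.comp x (hasFDerivAt_prodMk_right t x)
  rw [gradient, InnerProductSpace.toDual_symm_apply, h1.fderiv]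
  rfl

theorem IsMovingClosedSurface.exists_frame {T : ℝ} {Γ : ℝ → Set E3} {ν : ℝ → E3 → E3}
    (hΓ : IsMovingClosedSurface T Γ ν) {t : ℝ} (ht : t ∈ Icc 0 T) {y : E3} (hy : y ∈ Γ t) :
    ∃ e : OrthonormalBasis (Fin 3) ℝ E3, inner ℝ (ν t y) (e 2) ≠ (0 : ℝ) := by
  set b := EuclideanSpace.basisFun (Fin 3) ℝ
  obtain ⟨i, hi⟩ : ∃ i, inner ℝ (ν t y) (b i) ≠ (0 : ℝ) := by
    by_contra! hcon
    have : ν t y = 0 := by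
      rw [← b.sum_repr' (ν t y)]
      refine Finset.sum_eq_zero fun i _ => ?_
      rw [real_inner_comm, hcon, zero_smul]
    have h1 := hΓ.norm_normal t ht y hy
    simp [this] at h1
  refine ⟨b.reindex (Equiv.swap i 2), ?_⟩
  simpa using hi

/-- This is the implicit function theorem: `(t, x) ↦ (t, planeProj e x, φ (t, x))` is inverted
locally, the surface is where the last coordinate vanishes, and `h` is the `e 2` component of the
inverse there. Time is kept as a coordinate, so one chart serves all nearby times. -/
theorem IsMovingClosedSurface.exists_isGraphChart {T : ℝ} {Γ : ℝ → Set E3} {ν : ℝ → E3 → E3}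
    (hΓ : IsMovingClosedSurface T Γ ν) {t : ℝ} (ht : t ∈ Ioo 0 T) {y : E3} (hy : y ∈ Γ t) :
    ∃ (e : OrthonormalBasis (Fin 3) ℝ E3) (N : Set (ℝ × E3)) (D : Set (ℝ × E2)) (h : ℝ × E2 → ℝ),
      IsGraphChart T Γ ν e N D h ∧ (t, y) ∈ N := by
  obtain ⟨U, φ, hU, htU, hφ, hφΓ⟩ := hΓ.smooth t (Ioo_subset_Icc_self ht) y hy
  obtain ⟨e, he⟩ := hΓ.exists_frame (Ioo_subset_Icc_self ht) hy
  have hcd : ∀ p ∈ U, ContDiffAt ℝ ∞ φ p := fun p hp => hφ.contDiffAt (hU.mem_nhds hp)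
  have hdiff : ∀ p ∈ U, DifferentiableAt ℝ φ p := fun p hp =>
    (hcd p hp).differentiableAt (by simp)
  set Φ : ℝ × E3 → ℝ × E2 × ℝ := fun p => (p.1, planeProj e p.2, φ p) with hΦ
  have hΦcd : ∀ p ∈ U, ContDiffAt ℝ ∞ Φ p := fun p hp =>
    contDiffAt_fst.prodMk (((planeProj e).contDiff.contDiffAt.comp p contDiffAt_snd).prodMk
      (hcd p hp))
  have hΦd : ∀ p ∈ U, HasFDerivAt Φ ((ContinuousLinearMap.fst ℝ ℝ E3).prod
        (((planeProj e).comp (ContinuousLinearMap.snd ℝ ℝ E3)).prod (fderiv ℝ φ p))) p :=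
    fun p hp => hasFDerivAt_fst.prodMk
      (((planeProj e).hasFDerivAt.comp p hasFDerivAt_snd).prodMk (hdiff p hp).hasFDerivAt)
  -- Invertibility is needed at every point of `N`, not only at `(t, y)`, to make `h` smooth on all
  -- of `D`.
  set R : Set (ℝ × E3) := {p | p ∈ U ∧ fderiv ℝ φ p (0, e 2) ≠ 0} with hR
  have hRo : IsOpen R := by
    rw [isOpen_iff_mem_nhds]
    rintro p ⟨hp, hp2⟩
    have hc : ContinuousAt (fun p => fderiv ℝ φ p (0, e 2)) p :=
      ((hcd p hp).fderiv_right (m := 0) (by simp)).continuousAt.clm_apply continuousAt_const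
    filter_upwards [hU.mem_nhds hp, hc.eventually_ne hp2] with q h1 h2 using ⟨h1, h2⟩
  have htR : (t, y) ∈ R := by
    refine ⟨htU, ?_⟩
    obtain ⟨c, hc, hcν⟩ := (hφΓ t y htU (Ioo_subset_Icc_self ht)).2 hy
    rw [← inner_gradient_eq (hdiff _ htU), hcν, inner_smul_left]
    exact mul_ne_zero (by simpa using hc.ne') he
  have hequiv : ∀ p ∈ R, ∃ f' : (ℝ × E3) ≃L[ℝ] ℝ × E2 × ℝ,
      HasFDerivAt Φ (f' : ℝ × E3 →L[ℝ] ℝ × E2 × ℝ) p := by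
    intro p hp
    obtain ⟨f', hf'⟩ := exists_equiv_prod_planeProj e hp.2
    exact ⟨f', hf' ▸ hΦd p hp.1⟩
  obtain ⟨f₀, hf₀⟩ := hequiv _ htR
  set H := (hΦcd _ htU).toOpenPartialHomeomorph Φ hf₀ (by simp) with hH
  have hHc : ∀ p, H p = Φ p := fun p => rfl
  set N : Set (ℝ × E3) := H.source ∩ (R ∩ (Ioo 0 T ×ˢ univ)) with hN
  have hNo : IsOpen N := H.open_source.inter (hRo.inter (isOpen_Ioo.prod isOpen_univ))
  set ι : ℝ × E2 → ℝ × E2 × ℝ := fun p => (p.1, p.2, 0) with hι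
  have hιc : ContDiff ℝ ∞ ι := contDiff_fst.prodMk (contDiff_snd.prodMk contDiff_const)
  set D : Set (ℝ × E2) := ι ⁻¹' (H.target ∩ H.symm ⁻¹' N) with hD
  have hDo : IsOpen D := (H.symm.isOpen_inter_preimage hNo).preimage hιc.continuous
  set h : ℝ × E2 → ℝ := fun p => inner ℝ (e 2) (H.symm (ι p)).2 with hh
  have hsymm : ∀ p ∈ D, H.symm (ι p) = (p.1, graphMap e h p) ∧ φ (p.1, graphMap e h p) = 0 := by
    intro p hp
    have h1 : Φ (H.symm (ι p)) = ι p := H.right_inv hp.1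
    have h2 : (H.symm (ι p)).1 = p.1 := congrArg Prod.fst h1
    have h3 : planeProj e (H.symm (ι p)).2 = p.2 := congrArg (fun q => q.2.1) h1
    have h4 : φ (H.symm (ι p)) = 0 := congrArg (fun q => q.2.2) h1
    have h5 : H.symm (ι p) = (p.1, graphMap e h p) := by
      refine Prod.ext h2 ?_
      rw [← planeEmb_planeProj_add e (H.symm (ι p)).2, h3]
      rfl
    exact ⟨h5, h5 ▸ h4⟩
  have hcdh : ContDiffOn ℝ ∞ h D := by
    intro p hp
    obtain ⟨f', hf'⟩ := hequiv _ hp.2.2.1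
    have h1 : ContDiffAt ℝ ∞ H.symm (ι p) :=
      H.contDiffAt_symm hp.1 hf' (hΦcd _ hp.2.2.1.1)
    have h2 : ContDiffAt ℝ ∞ (fun p => (H.symm (ι p)).2) p :=
      contDiffAt_snd.comp p (h1.comp p hιc.contDiffAt)
    exact ((innerSL ℝ (e 2)).contDiff.contDiffAt.comp p h2).contDiffWithinAt
  have hzero : ∀ p ∈ N, p.2 ∈ Γ p.1 ↔ φ p = 0 := fun p hp =>
    (hφΓ p.1 p.2 hp.2.1.1 (Ioo_subset_Icc_self hp.2.2.1)).1
  have hmap : ∀ p ∈ D, (p.1, graphMap e h p) ∈ N := fun p hp => (hsymm p hp).1 ▸ hp.2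
  refine ⟨e, N, D, h, ⟨hNo, hDo, fun p hp => hp.2.2.1, hcdh, fun p hp => ?_, fun s x hsx hx => ?_,
    fun p hp => ?_⟩, (hΦcd _ htU).mem_toOpenPartialHomeomorph_source hf₀ (by simp), htR, ht,
    mem_univ _⟩
  · exact ⟨hmap p hp, (hzero _ (hmap p hp)).2 (hsymm p hp).2⟩
  · have h1 : φ (s, x) = 0 := (hzero _ hsx).1 hx
    have h2 : H (s, x) = ι (s, planeProj e x) := by
      rw [hHc, hΦ]; simp [h1, hι]
    have h3 : H.symm (ι (s, planeProj e x)) = (s, x) := by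
      rw [← h2, H.left_inv hsx.1]
    have h4 : (s, planeProj e x) ∈ D := by
      refine ⟨?_, ?_⟩
      · rw [← h2]; exact H.map_source hsx.1
      · rw [mem_preimage, h3]; exact hsx
    refine ⟨h4, ?_⟩
    have := (hsymm _ h4).1
    rw [h3] at this
    exact (congrArg Prod.snd this).symm
  · have hpN := hmap p hp
    have hpU := hpN.2.1.1
    obtain ⟨c, hc, hcν⟩ := (hφΓ p.1 _ hpU (Ioo_subset_Icc_self hpN.2.2.1)).2
      ((hzero _ hpN).2 (hsymm p hp).2)
    set φ' := fderiv ℝ φ (p.1, graphMap e h p)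
    have hhd : HasFDerivAt h (fderiv ℝ h p) p :=
      ((hcdh.contDiffAt (hDo.mem_nhds hp)).differentiableAt (by simp)).hasFDerivAt
    have hgd : HasFDerivAt (fun q : ℝ × E2 => (q.1, graphMap e h q))
        ((ContinuousLinearMap.fst ℝ ℝ E2).prod
          ((planeEmb e).comp (ContinuousLinearMap.snd ℝ ℝ E2) +
            (fderiv ℝ h p).smulRight (e 2))) p :=
      hasFDerivAt_fst.prodMk
        (((planeEmb e).hasFDerivAt.comp p hasFDerivAt_snd).add (hhd.smul_const (e 2)))
    have hcomp := (hdiff _ hpU).hasFDerivAt.comp p hgd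
    have hconst : (φ ∘ fun q : ℝ × E2 => (q.1, graphMap e h q)) =ᶠ[𝓝 p] fun _ => 0 := by
      filter_upwards [hDo.mem_nhds hp] with q hq using (hsymm q hq).2
    have hz := hcomp.unique ((hasFDerivAt_const (0 : ℝ) p).congr_of_eventuallyEq hconst)
    set g := gradient (fun z => φ (p.1, z)) (graphMap e h p) with hg
    -- Differentiating `φ = 0` along the graph makes `g` orthogonal to the tangent vectors `e
    -- k.castSucc + slope2 h k p • e 2`.
    have hk : ∀ k : Fin 2, (inner ℝ g (e k.castSucc) : ℝ) = -slope2 h k p * inner ℝ g (e 2) := by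
      intro k
      have h1 := congrArg (fun A : ℝ × E2 →L[ℝ] ℝ => A (planeDir k)) hz
      have h2 : φ' (0, planeEmb e (EuclideanSpace.single k 1) + slope2 h k p • e 2) = 0 := h1
      rw [← inner_gradient_eq (hdiff _ hpU), inner_add_right, inner_smul_right] at h2
      have h3 : planeEmb e (EuclideanSpace.single k 1) = e k.castSucc := by
        fin_cases k <;> simp [planeEmb_apply]
      rw [h3] at h2
      linarith
    refine ⟨c⁻¹ * inner ℝ g (e 2), ?_⟩
    have hνg : ν p.1 (graphMap e h p) = c⁻¹ • g := by
      rw [hcν, smul_smul, inv_mul_cancel₀ hc.ne', one_smul]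
    rw [hνg, mul_smul]
    congr 1
    conv_lhs => rw [← e.sum_repr' g]
    have h0 := hk 0
    have h1 := hk 1
    simp only [Fin.castSucc_zero, Fin.castSucc_one] at h0 h1
    rw [Fin.sum_univ_three, graphNormal, real_inner_comm, real_inner_comm g (e 1), h0, h1,
      real_inner_comm]
    module

/-- Near each point of the surface, `ν` is the restriction of ∇φ / |∇φ|, the positive factor `c`
fixing the sign. -/
theorem IsMovingClosedSurface.contDiffOn_normal {T : ℝ} {Γ : ℝ → Set E3} {ν : ℝ → E3 → E3}
    (hΓ : IsMovingClosedSurface T Γ ν) :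
    ContDiffOn ℝ 1 (Function.uncurry ν) (spaceTime (Ioo 0 T) Γ) := by
  rintro ⟨t, y⟩ ⟨ht, hy⟩
  obtain ⟨U, φ, hU, htU, hφ, hφΓ⟩ := hΓ.smooth t (Ioo_subset_Icc_self ht) y hy
  have hcd : ∀ p ∈ U, ContDiffAt ℝ ∞ φ p := fun p hp => hφ.contDiffAt (hU.mem_nhds hp)
  have hdiff : ∀ p ∈ U, DifferentiableAt ℝ φ p := fun p hp =>
    (hcd p hp).differentiableAt (by simp)
  set g : ℝ × E3 → E3 := fun p => (InnerProductSpace.toDual ℝ E3).symm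
    ((fderiv ℝ φ p).comp (ContinuousLinearMap.inr ℝ ℝ E3)) with hg
  have hgg : ∀ p ∈ U, gradient (fun z => φ (p.1, z)) p.2 = g p := by
    intro p hp
    refine ext_inner_right ℝ fun ξ => ?_
    rw [inner_gradient_eq (hdiff p hp), hg, InnerProductSpace.toDual_symm_apply]
    rfl
  have hgc : ContDiffAt ℝ 1 g (t, y) := by
    have h1 : ContDiffAt ℝ 1 (fderiv ℝ φ) (t, y) :=
      (hcd _ htU).fderiv_right (by exact WithTop.coe_le_coe.2 le_top)
    have h2 : ContDiffAt ℝ 1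
        (fun p => (fderiv ℝ φ p).comp (ContinuousLinearMap.inr ℝ ℝ E3)) (t, y) :=
      h1.clm_comp contDiffAt_const
    exact (InnerProductSpace.toDual ℝ E3).symm.contDiff.contDiffAt.comp _ h2
  have hνg : ∀ p ∈ U, p.1 ∈ Ioo 0 T → p.2 ∈ Γ p.1 →
      g p ≠ 0 ∧ ν p.1 p.2 = ‖g p‖⁻¹ • g p := by
    intro p hp hpT hpΓ
    obtain ⟨c, hc, hcν⟩ := (hφΓ p.1 p.2 hp (Ioo_subset_Icc_self hpT)).2 hpΓ
    rw [hgg p hp] at hcν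
    have hn : ‖g p‖ = c := by
      rw [hcν, norm_smul, hΓ.norm_normal _ (Ioo_subset_Icc_self hpT) _ hpΓ, mul_one,
        Real.norm_of_nonneg hc.le]
    refine ⟨fun h0 => hc.ne' (by rw [← hn, h0, norm_zero]), ?_⟩
    rw [hn, hcν, smul_smul, inv_mul_cancel₀ hc.ne', one_smul]
  have hg0 := (hνg _ htU ht hy).1
  have hc : ContDiffAt ℝ 1 (fun p => ‖g p‖⁻¹ • g p) (t, y) :=
    ((hgc.norm ℝ hg0).inv (norm_ne_zero_iff.2 hg0)).smul hgc
  refine hc.contDiffWithinAt.congr_of_eventuallyEq ?_ (hνg _ htU ht hy).2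
  filter_upwards [self_mem_nhdsWithin, mem_nhdsWithin_of_mem_nhds (hU.mem_nhds htU)] with p hp hpU
    using (hνg p hpU hp.1 hp.2).2

/-! ### Tangential calculus in a graph chart -/

/-- A field on the moving surface in the coordinates of a graph chart. -/
noncomputable def graphPullback {X : Type*} (e : OrthonormalBasis (Fin 3) ℝ E3) (h : ℝ × E2 → ℝ)
    (F : ℝ → E3 → X) (p : ℝ × E2) : X :=
  F p.1 (graphMap e h p)

/-- The derivative of `graphMap`. -/
noncomputable def graphDeriv (e : OrthonormalBasis (Fin 3) ℝ E3) (h : ℝ × E2 → ℝ) (p : ℝ × E2) :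
    ℝ × E2 →L[ℝ] E3 :=
  (planeEmb e).comp (ContinuousLinearMap.snd ℝ ℝ E2) + (fderiv ℝ h p).smulRight (e 2)

theorem graphDeriv_apply (e : OrthonormalBasis (Fin 3) ℝ E3) (h : ℝ × E2 → ℝ) (p X : ℝ × E2) :
    graphDeriv e h p X = planeEmb e X.2 + fderiv ℝ h p X • e 2 := rfl

theorem inner_tanProj_comm (n x y : E3) :
    (inner ℝ (tanProj n x) y : ℝ) = inner ℝ x (tanProj n y) := by
  simp only [tanProj, inner_sub_left, inner_sub_right, inner_smul_left, inner_smul_right,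
    real_inner_comm, RCLike.conj_to_real]
  ring

theorem inner_normal_tanProj {n : E3} (hn : ‖n‖ = 1) (x : E3) :
    (inner ℝ n (tanProj n x) : ℝ) = 0 := by
  simp [tanProj, inner_sub_right, inner_smul_right, hn]

theorem inner_gradientWithin_eq (f : E3 → ℝ) (s : Set E3) (y ξ : E3) :
    inner ℝ (gradientWithin f s y) ξ = fderivWithin ℝ f s y ξ := by
  rw [gradientWithin, InnerProductSpace.toDual_symm_apply]

theorem areaDensity_sq (h : ℝ × E2 → ℝ) (p : ℝ × E2) :
    areaDensity h p ^ 2 = 1 + slope2 h 0 p ^ 2 + slope2 h 1 p ^ 2 :=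
  Real.sq_sqrt (by positivity)

theorem areaDensity_pos (h : ℝ × E2 → ℝ) (p : ℝ × E2) : 0 < areaDensity h p :=
  Real.sqrt_pos.2 (by positivity)

theorem fderiv_plane_eq (h : ℝ × E2 → ℝ) (p : ℝ × E2) (η : E2) :
    fderiv ℝ h p (0, η) = η 0 * slope2 h 0 p + η 1 * slope2 h 1 p := by
  rw [planeDir_decomp η, map_add, map_smul, map_smul]
  rfl

theorem inner_graphNormal (e : OrthonormalBasis (Fin 3) ℝ E3) (h : ℝ × E2 → ℝ) (p : ℝ × E2)
    (x : E3) : (inner ℝ (graphNormal e h p) x : ℝ) =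
      inner ℝ (e 2) x - slope2 h 0 p * inner ℝ (e 0) x - slope2 h 1 p * inner ℝ (e 1) x := by
  simp [graphNormal, inner_sub_left, inner_smul_left]

theorem norm_graphNormal_sq (e : OrthonormalBasis (Fin 3) ℝ E3) (h : ℝ × E2 → ℝ) (p : ℝ × E2) :
    ‖graphNormal e h p‖ ^ 2 = areaDensity h p ^ 2 := by
  rw [← real_inner_self_eq_norm_sq, inner_graphNormal, areaDensity_sq]
  simp [graphNormal, inner_sub_right, inner_smul_right]
  ring

section charts

variable {T : ℝ} {Γ : ℝ → Set E3} {ν : ℝ → E3 → E3} {e : OrthonormalBasis (Fin 3) ℝ E3}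
  {N : Set (ℝ × E3)} {D : Set (ℝ × E2)} {h : ℝ × E2 → ℝ} {X : Type*} [NormedAddCommGroup X]
  [NormedSpace ℝ X]

namespace IsGraphChart


theorem contDiffAt (hc : IsGraphChart T Γ ν e N D h) {p : ℝ × E2} (hp : p ∈ D) :
    ContDiffAt ℝ ∞ h p :=
  hc.contDiffOn.contDiffAt (hc.isOpen_target.mem_nhds hp)

theorem hasFDerivAt (hc : IsGraphChart T Γ ν e N D h) {p : ℝ × E2} (hp : p ∈ D) :
    HasFDerivAt h (fderiv ℝ h p) p :=
  ((hc.contDiffAt hp).differentiableAt (by simp)).hasFDerivAt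

theorem contDiffAt_fderiv (hc : IsGraphChart T Γ ν e N D h) {p : ℝ × E2} (hp : p ∈ D) :
    ContDiffAt ℝ 1 (fderiv ℝ h) p :=
  (hc.contDiffAt hp).fderiv_right (by exact WithTop.coe_le_coe.2 le_top)

theorem contDiffAt_slope2 (hc : IsGraphChart T Γ ν e N D h) {p : ℝ × E2} (hp : p ∈ D)
    (k : Fin 2) : ContDiffAt ℝ 1 (slope2 h k) p :=
  (hc.contDiffAt_fderiv hp).clm_apply contDiffAt_const

theorem contDiffAt_areaDensity (hc : IsGraphChart T Γ ν e N D h) {p : ℝ × E2} (hp : p ∈ D) :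
    ContDiffAt ℝ 1 (areaDensity h) p :=
  ((contDiffAt_const.add ((hc.contDiffAt_slope2 hp 0).pow 2)).add
    ((hc.contDiffAt_slope2 hp 1).pow 2)).sqrt (by positivity)

theorem contDiffAt_graphMap (hc : IsGraphChart T Γ ν e N D h) {p : ℝ × E2} (hp : p ∈ D) :
    ContDiffAt ℝ ∞ (graphMap e h) p :=
  ((planeEmb e).contDiff.contDiffAt.comp p contDiffAt_snd).add
    ((hc.contDiffAt hp).smul contDiffAt_const)

theorem hasFDerivAt_graphMap (hc : IsGraphChart T Γ ν e N D h) {p : ℝ × E2} (hp : p ∈ D) :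
    HasFDerivAt (graphMap e h) (graphDeriv e h p) p :=
  ((planeEmb e).hasFDerivAt.comp p hasFDerivAt_snd).add ((hc.hasFDerivAt hp).smul_const (e 2))

theorem graph_mem_spaceTime (hc : IsGraphChart T Γ ν e N D h) {p : ℝ × E2} (hp : p ∈ D) :
    (p.1, graphMap e h p) ∈ spaceTime (Ioo 0 T) Γ :=
  ⟨hc.fst_mem _ (hc.map_mem p hp).1, (hc.map_mem p hp).2⟩

theorem contDiffAt_pullback (hc : IsGraphChart T Γ ν e N D h) {F : ℝ → E3 → X}
    (hF : ContDiffOn ℝ 1 (Function.uncurry F) (spaceTime (Ioo 0 T) Γ)) {p : ℝ × E2} (hp : p ∈ D) :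
    ContDiffAt ℝ 1 (graphPullback e h F) p := by
  have h1 : ContDiffOn ℝ 1 (fun q : ℝ × E2 => (q.1, graphMap e h q)) D := fun q hq =>
    (contDiffAt_fst.prodMk ((hc.contDiffAt_graphMap hq).of_le
      (by exact WithTop.coe_le_coe.2 le_top))).contDiffWithinAt
  have h2 := hF.comp h1 fun q hq => hc.graph_mem_spaceTime hq
  exact h2.contDiffAt (hc.isOpen_target.mem_nhds hp)

/-- A derivative within a hypersurface is determined only in tangent directions. The chain rule
shows that in those directions whichever derivative `fderivWithin` selects agrees with the ordinary
derivative of the pullback. -/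
theorem fderiv_pullback (hc : IsGraphChart T Γ ν e N D h) {F : ℝ → E3 → X}
    (hF : ContDiffOn ℝ 1 (Function.uncurry F) (spaceTime (Ioo 0 T) Γ)) {p : ℝ × E2} (hp : p ∈ D)
    (Y : ℝ × E2) : fderiv ℝ (graphPullback e h F) p Y =
      fderivWithin ℝ (Function.uncurry F) (spaceTime (Ioo 0 T) Γ) (p.1, graphMap e h p)
        (Y.1, graphDeriv e h p Y) := by
  have h1 := ((hF.differentiableOn one_ne_zero) _ (hc.graph_mem_spaceTime hp)).hasFDerivWithinAt
  have h2 : HasFDerivAt (fun q : ℝ × E2 => (q.1, graphMap e h q))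
      ((ContinuousLinearMap.fst ℝ ℝ E2).prod (graphDeriv e h p)) p :=
    hasFDerivAt_fst.prodMk (hc.hasFDerivAt_graphMap hp)
  have h3 := h1.comp_hasFDerivAt p h2 (by
    filter_upwards [hc.isOpen_target.mem_nhds hp] with q hq using hc.graph_mem_spaceTime hq)
  change HasFDerivAt (graphPullback e h F) _ p at h3
  rw [h3.fderiv]
  rfl

end IsGraphChart

theorem differentiableWithinAt_slice {F : ℝ → E3 → X}
    (hF : ContDiffOn ℝ 1 (Function.uncurry F) (spaceTime (Ioo 0 T) Γ)) {s : ℝ} {x : E3}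
    (hs : s ∈ Ioo 0 T) (hx : x ∈ Γ s) : DifferentiableWithinAt ℝ (F s) (Γ s) x := by
  have h1 := (hF.differentiableOn one_ne_zero) (s, x) ⟨hs, hx⟩
  exact h1.comp x (f := fun z => (s, z)) (by fun_prop) fun z hz => ⟨hs, hz⟩

namespace IsGraphChart

theorem fderiv_pullback_slice (hc : IsGraphChart T Γ ν e N D h) {F : ℝ → E3 → X}
    (hF : ContDiffOn ℝ 1 (Function.uncurry F) (spaceTime (Ioo 0 T) Γ)) {p : ℝ × E2} (hp : p ∈ D)
    (η : E2) : fderiv ℝ (graphPullback e h F) p (0, η) =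
      fderivWithin ℝ (F p.1) (Γ p.1) (graphMap e h p) (graphDeriv e h p (0, η)) := by
  obtain ⟨hs, hx⟩ := hc.graph_mem_spaceTime hp
  have h1 := (differentiableWithinAt_slice hF hs hx).hasFDerivWithinAt
  have hsl : HasFDerivAt (fun y : E2 => (p.1, y)) (ContinuousLinearMap.inr ℝ ℝ E2) p.2 :=
    hasFDerivAt_prodMk_right p.1 p.2
  have h2 : HasFDerivAt (fun y : E2 => graphMap e h (p.1, y))
      ((graphDeriv e h p).comp (ContinuousLinearMap.inr ℝ ℝ E2)) p.2 :=
    HasFDerivAt.comp (g := graphMap e h) p.2 (hc.hasFDerivAt_graphMap hp) hsl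
  have h3 := h1.comp_hasFDerivAt p.2 h2 (by
    have : ∀ᶠ y in 𝓝 p.2, (p.1, y) ∈ D :=
      hsl.continuousAt.eventually (hc.isOpen_target.mem_nhds hp)
    filter_upwards [this] with y hy using (hc.map_mem _ hy).2)
  have h4 := HasFDerivAt.comp (g := graphPullback e h F) p.2
    ((hc.contDiffAt_pullback hF hp).differentiableAt one_ne_zero).hasFDerivAt hsl
  exact congrArg (fun A : E2 →L[ℝ] X => A η) (h4.unique h3)

theorem exists_normal_eq (hΓ : IsMovingClosedSurface T Γ ν) (hc : IsGraphChart T Γ ν e N D h)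
    {p : ℝ × E2} (hp : p ∈ D) : ∃ c : ℝ, ν p.1 (graphMap e h p) = c • graphNormal e h p ∧
      c ^ 2 * areaDensity h p ^ 2 = 1 := by
  obtain ⟨c, hcν⟩ := hc.normal p hp
  refine ⟨c, hcν, ?_⟩
  have h1 := hΓ.norm_normal p.1 (Ioo_subset_Icc_self (hc.graph_mem_spaceTime hp).1) _
    (hc.map_mem p hp).2
  rw [← norm_graphNormal_sq e, ← mul_pow, ← sq_abs, abs_mul, abs_norm, ← Real.norm_eq_abs,
    ← norm_smul, ← hcν, h1, one_pow]

/-- Orthogonality to the graph normal says that the `e 2` component of `τ` is the slope combination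
of its planar components. -/
theorem graphDeriv_of_inner_eq_zero (hΓ : IsMovingClosedSurface T Γ ν)
    (hc : IsGraphChart T Γ ν e N D h) {p : ℝ × E2} (hp : p ∈ D) {τ : E3}
    (hτ : inner ℝ (ν p.1 (graphMap e h p)) τ = (0 : ℝ)) :
    graphDeriv e h p (0, planeProj e τ) = τ := by
  obtain ⟨c, hcν, hcW⟩ := hc.exists_normal_eq hΓ hp
  have hc0 : c ≠ 0 := by rintro rfl; simp at hcW
  rw [hcν, inner_smul_left, inner_graphNormal] at hτ
  have h1 := (mul_eq_zero.1 hτ).resolve_left (by simpa using hc0)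
  conv_rhs => rw [← planeEmb_planeProj_add e τ]
  rw [graphDeriv_apply, fderiv_plane_eq, planeProj_apply, planeProj_apply]
  congr 2
  simp only [Fin.castSucc_zero, Fin.castSucc_one]
  linarith

/-- The kinematic condition: `(1, w)` is tangent to the space-time surface. The curve defining the
normal velocity stays on the graph, so its own velocity `w₀` qualifies, and `w - w₀` is orthogonal
to `ν`, hence tangent. -/
theorem graphDeriv_of_isNormalVelocityAt (hΓ : IsMovingClosedSurface T Γ ν)
    (hc : IsGraphChart T Γ ν e N D h) {p : ℝ × E2} (hp : p ∈ D) {w : E3}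
    (hw : IsNormalVelocityAt Γ ν p.1 (graphMap e h p) (inner ℝ w (ν p.1 (graphMap e h p)))) :
    graphDeriv e h p (1, planeProj e w) = w := by
  obtain ⟨γ, w₀, hγ0, hγ, hγd, hw₀⟩ := hw
  have hpN := (hc.map_mem p hp).1
  have hpe : (p.1, planeProj e (γ p.1)) = p := by rw [hγ0, planeProj_graphMap]
  have hev : ∀ᶠ s in 𝓝 p.1, graphMap e h (s, planeProj e (γ s)) = γ s := by
    have : ContinuousAt (fun s => (s, γ s)) p.1 := continuousAt_id.prodMk hγd.continuousAt
    have hN : N ∈ 𝓝 (p.1, γ p.1) := by rw [hγ0]; exact hc.isOpen_source.mem_nhds hpN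
    filter_upwards [hγ, this hN] with s h1 h2 using (hc.proj_mem s _ h2 h1).2
  have h1 : HasDerivAt (fun s => (s, planeProj e (γ s))) ((1 : ℝ), planeProj e w₀) p.1 :=
    (hasDerivAt_id p.1).prodMk ((planeProj e).hasFDerivAt.comp_hasDerivAt p.1 hγd)
  have h2 : HasDerivAt (fun s => graphMap e h (s, planeProj e (γ s)))
      (graphDeriv e h p (1, planeProj e w₀)) p.1 := by
    refine HasFDerivAt.comp_hasDerivAt (l := graphMap e h) p.1 ?_ h1
    rw [hpe]
    exact hc.hasFDerivAt_graphMap hp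
  have h3 : graphDeriv e h p (1, planeProj e w₀) = w₀ :=
    h2.unique (hγd.congr_of_eventuallyEq hev)
  have h4 : graphDeriv e h p (0, planeProj e (w - w₀)) = w - w₀ := by
    refine hc.graphDeriv_of_inner_eq_zero hΓ hp ?_
    rw [real_inner_comm, inner_sub_left, hw₀, sub_self]
  have h5 : ((1 : ℝ), planeProj e w) = (1, planeProj e w₀) + (0, planeProj e (w - w₀)) := by
    simp
  rw [h5, map_add, h3, h4]
  abel

/-- The `i`-th summand differentiates `wᵢ` along the projected `i`-th unit vector, whose `k`-th
planar coordinate is, by symmetry of the projection, the `i`-th component of the projected `e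
k.castSucc`. Summing over `i` leaves the inner products. -/
theorem surfDiv_eq (hΓ : IsMovingClosedSurface T Γ ν) (hc : IsGraphChart T Γ ν e N D h)
    {w : ℝ → E3 → E3} (hw : ContDiffOn ℝ 1 (Function.uncurry w) (spaceTime (Ioo 0 T) Γ))
    {p : ℝ × E2} (hp : p ∈ D) :
    surfDiv (Γ p.1) (ν p.1) (w p.1) (graphMap e h p) =
      ∑ k : Fin 2, inner ℝ (fderiv ℝ (graphPullback e h w) p (planeDir k))
        (tanProj (ν p.1 (graphMap e h p)) (e k.castSucc)) := by
  set n := ν p.1 (graphMap e h p) with hn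
  have hn1 : ‖n‖ = 1 := hΓ.norm_normal p.1 (Ioo_subset_Icc_self (hc.graph_mem_spaceTime hp).1) _
    (hc.map_mem p hp).2
  have hcoord : ∀ (x : E3) (i : Fin 3), x i = inner ℝ x (EuclideanSpace.single i (1 : ℝ)) := by
    intro x i
    simp [EuclideanSpace.inner_single_right]
  have hi : ∀ i : Fin 3, surfGrad (Γ p.1) (ν p.1) (fun z => w p.1 z i) (graphMap e h p) i =
      ∑ k : Fin 2, tanProj n (e k.castSucc) i *
        fderiv ℝ (graphPullback e h w) p (planeDir k) i := by
    intro i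
    set τ := tanProj n (EuclideanSpace.single i (1 : ℝ)) with hτ
    have hwi : ContDiffOn ℝ 1 (Function.uncurry fun s z => w s z i) (spaceTime (Ioo 0 T) Γ) :=
      ContDiff.comp_contDiffOn (g := (EuclideanSpace.proj i : E3 →L[ℝ] ℝ))
        (EuclideanSpace.proj i : E3 →L[ℝ] ℝ).contDiff hw
    rw [hcoord, surfGrad, inner_tanProj_comm, ← hn, ← hτ, inner_gradientWithin_eq,
      ← hc.graphDeriv_of_inner_eq_zero hΓ hp (τ := τ) (inner_normal_tanProj hn1 _),
      ← hc.fderiv_pullback_slice hwi hp]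
    have hcomp : fderiv ℝ (graphPullback e h fun s z => w s z i) p =
        (EuclideanSpace.proj i : E3 →L[ℝ] ℝ).comp (fderiv ℝ (graphPullback e h w) p) := by
      have h1 := ((hc.contDiffAt_pullback hw hp).differentiableAt one_ne_zero).hasFDerivAt
      have h2 := HasFDerivAt.comp (g := (EuclideanSpace.proj i : E3 →L[ℝ] ℝ)) p
        (EuclideanSpace.proj i : E3 →L[ℝ] ℝ).hasFDerivAt h1
      exact h2.fderiv
    have hπ : ∀ k : Fin 2, planeProj e τ k = tanProj n (e k.castSucc) i := by
      intro k
      rw [planeProj_apply, hcoord, hτ, ← inner_tanProj_comm]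
    rw [hcomp, planeDir_decomp, map_add, map_smul, map_smul, Fin.sum_univ_two, hπ, hπ]
    rfl
  rw [surfDiv, Finset.sum_congr rfl fun i _ => hi i, Finset.sum_comm]
  refine Finset.sum_congr rfl fun k _ => ?_
  rw [PiLp.inner_apply]
  rfl

/-- With Y = (1, planar part of u), the kinematic condition reads e₂·u = Dh(Y). Differentiated in
direction k, it gives graphNormal·∂ₖu = D²h(Y, ∂ₖ), the slope terms cancelling. Weighted by the
slopes, the same second derivatives add up to W · DW(Y). -/
theorem surfDiv_eq_coord (hΓ : IsMovingClosedSurface T Γ ν) (hc : IsGraphChart T Γ ν e N D h)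
    {w : ℝ → E3 → E3} (hw : ContDiffOn ℝ 1 (Function.uncurry w) (spaceTime (Ioo 0 T) Γ))
    (hwν : ∀ s ∈ Ioo 0 T, ∀ y ∈ Γ s, IsNormalVelocityAt Γ ν s y (inner ℝ (w s y) (ν s y)))
    {p : ℝ × E2} (hp : p ∈ D) :
    areaDensity h p * surfDiv (Γ p.1) (ν p.1) (w p.1) (graphMap e h p) =
      fderiv ℝ (areaDensity h) p (1, planeProj e (graphPullback e h w p)) +
        areaDensity h p * ∑ k : Fin 2,
          fderiv ℝ (fun q => planeProj e (graphPullback e h w q) k) p (planeDir k) := by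
  obtain ⟨c, hcν, hcW⟩ := hc.exists_normal_eq hΓ hp
  have hW := areaDensity_sq h p
  have hW0 := areaDensity_pos h p
  set u := graphPullback e h w with hu
  have hud : HasFDerivAt u (fderiv ℝ u p) p :=
    ((hc.contDiffAt_pullback hw hp).differentiableAt one_ne_zero).hasFDerivAt
  have hDd : HasFDerivAt (fderiv ℝ h) (fderiv ℝ (fderiv ℝ h) p) p :=
    ((hc.contDiffAt_fderiv hp).differentiableAt one_ne_zero).hasFDerivAt
  set Y : ℝ × E2 := (1, planeProj e (u p)) with hY
  have hsymm : ∀ k, fderiv ℝ (fderiv ℝ h) p (planeDir k) Y = fderiv ℝ (fderiv ℝ h) p Y (planeDir k) :=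
    fun k => ((hc.contDiffAt hp).isSymmSndFDerivAt (by
      rw [minSmoothness_of_isRCLikeNormedField]; exact WithTop.coe_le_coe.2 le_top)).eq _ _
  have h3 : ∀ k, inner ℝ (e 2) (fderiv ℝ u p (planeDir k)) =
      fderiv ℝ (fderiv ℝ h) p Y (planeDir k) +
        fderiv ℝ h p (0, planeProj e (fderiv ℝ u p (planeDir k))) := by
    intro k
    have hl : HasFDerivAt (fun q => inner ℝ (e 2) (u q)) ((innerSL ℝ (e 2)).comp (fderiv ℝ u p)) p :=
      (innerSL ℝ (e 2)).hasFDerivAt.comp p hud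
    have hY' : HasFDerivAt (fun q => ((1 : ℝ), planeProj e (u q)))
        ((0 : ℝ × E2 →L[ℝ] ℝ).prod ((planeProj e).comp (fderiv ℝ u p))) p :=
      (hasFDerivAt_const (1 : ℝ) p).prodMk ((planeProj e).hasFDerivAt.comp p hud)
    have hr := hDd.clm_apply hY'
    -- The kinematic condition holds throughout the chart, so it may be differentiated at `p`.
    have heq : (fun q => inner ℝ (e 2) (u q)) =ᶠ[𝓝 p]
        fun q => fderiv ℝ h q (1, planeProj e (u q)) := by
      filter_upwards [hc.isOpen_target.mem_nhds hp] with q hq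
      obtain ⟨hs, hx⟩ := hc.graph_mem_spaceTime hq
      have := hc.graphDeriv_of_isNormalVelocityAt hΓ hq (hwν _ hs _ hx)
      change inner ℝ (e 2) (w q.1 (graphMap e h q)) = _
      conv_lhs => rw [← this]
      rw [graphDeriv_apply, inner_two_planeEmb_add]
      rfl
    have := congrArg (fun A : ℝ × E2 →L[ℝ] ℝ => A (planeDir k))
      (hl.unique (hr.congr_of_eventuallyEq heq))
    rw [← hsymm k, add_comm]
    exact this
  have hWd : areaDensity h p * fderiv ℝ (areaDensity h) p Y =
      ∑ k, slope2 h k p * fderiv ℝ (fderiv ℝ h) p Y (planeDir k) := by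
    have hs : ∀ k, HasFDerivAt (slope2 h k) ((ContinuousLinearMap.apply ℝ ℝ (planeDir k)).comp
        (fderiv ℝ (fderiv ℝ h) p)) p := fun k =>
      (ContinuousLinearMap.apply ℝ ℝ (planeDir k)).hasFDerivAt.comp p hDd
    have hl := (((hc.contDiffAt_areaDensity hp).differentiableAt one_ne_zero).hasFDerivAt).pow 2
    have hr := ((hasFDerivAt_const (1 : ℝ) p).add ((hs 0).pow 2)).add ((hs 1).pow 2)
    have := congrArg (fun A : ℝ × E2 →L[ℝ] ℝ => A Y) (hl.unique
      (hr.congr_of_eventuallyEq (Eventually.of_forall fun q => areaDensity_sq h q)))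
    simp at this
    rw [Fin.sum_univ_two]
    linarith
  have huk : ∀ k : Fin 2, fderiv ℝ (fun q => planeProj e (u q) k) p (planeDir k) =
      inner ℝ (e k.castSucc) (fderiv ℝ u p (planeDir k)) := by
    intro k
    have : HasFDerivAt (fun q => planeProj e (u q) k)
        ((innerSL ℝ (e k.castSucc)).comp (fderiv ℝ u p)) p :=
      (innerSL ℝ (e k.castSucc)).hasFDerivAt.comp p hud
    rw [this.fderiv]
    rfl
  rw [hc.surfDiv_eq hΓ hw hp, hcν]
  have hterm : ∀ k : Fin 2, inner ℝ (fderiv ℝ u p (planeDir k))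
      (tanProj (c • graphNormal e h p) (e k.castSucc)) =
      inner ℝ (e k.castSucc) (fderiv ℝ u p (planeDir k)) +
        c ^ 2 * slope2 h k p * fderiv ℝ (fderiv ℝ h) p Y (planeDir k) := by
    intro k
    have hnk : inner ℝ (graphNormal e h p) (e k.castSucc) = -slope2 h k p := by
      rw [inner_graphNormal]
      fin_cases k <;> simp
    have h3k := h3 k
    rw [fderiv_plane_eq, planeProj_apply, planeProj_apply] at h3k
    rw [tanProj, inner_sub_right, inner_smul_left, hnk, inner_smul_right, inner_smul_right,
      real_inner_comm, real_inner_comm (graphNormal e h p), inner_graphNormal, h3k]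
    simp only [RCLike.conj_to_real, Fin.castSucc_zero, Fin.castSucc_one]
    ring
  rw [Finset.sum_congr rfl fun k _ => hterm k, Finset.sum_congr rfl fun k _ => huk k]
  rw [Fin.sum_univ_two] at hWd ⊢
  rw [Fin.sum_univ_two]
  have hc2 : c ^ 2 * areaDensity h p = (areaDensity h p)⁻¹ := by
    field_simp
    linarith
  have hWd' : fderiv ℝ (areaDensity h) p Y = c ^ 2 * areaDensity h p *
      (slope2 h 0 p * fderiv ℝ (fderiv ℝ h) p Y (planeDir 0) +
        slope2 h 1 p * fderiv ℝ (fderiv ℝ h) p Y (planeDir 1)) := by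
    rw [← hWd, hc2, inv_mul_cancel_left₀ hW0.ne']
  rw [hWd']
  ring

end IsGraphChart

end charts

/-- The material derivative of a scalar field along `w`. -/
noncomputable def scalarMaterialDeriv (T : ℝ) (Γ : ℝ → Set E3) (w : ℝ → E3 → E3) (F : ℝ → E3 → ℝ)
    (t : ℝ) (y : E3) : ℝ :=
  fderivWithin ℝ (Function.uncurry F) (spaceTime (Ioo 0 T) Γ) (t, y) (1, w t y)

/-! ### Zero extension and integrals over the plane -/

/-- Every point off `D` has a neighborhood missing `K`, so no regularity is lost across the boundary
of `D`. -/
theorem contDiff_indicator_of_compact {E : Type*} [NormedAddCommGroup E] [NormedSpace ℝ E]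
    {g : E → ℝ} {D K : Set E} (hK : IsCompact K) (hD : IsOpen D) (hKD : K ⊆ D)
    (hg : ∀ p ∈ D, ContDiffAt ℝ 1 g p) (h0 : ∀ p ∈ D, p ∉ K → g p = 0) :
    ContDiff ℝ 1 (D.indicator g) ∧ HasCompactSupport (D.indicator g) ∧
      (∀ p ∈ D, fderiv ℝ (D.indicator g) p = fderiv ℝ g p) ∧
      ∀ p ∉ D, fderiv ℝ (D.indicator g) p = 0 := by
  have hz : ∀ p ∉ K, D.indicator g p = 0 := by
    intro p hp
    by_cases hpD : p ∈ D
    · rw [indicator_of_mem hpD, h0 p hpD hp]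
    · rw [indicator_of_notMem hpD]
  have hin : ∀ p ∈ D, D.indicator g =ᶠ[𝓝 p] g := fun p hp => by
    filter_upwards [hD.mem_nhds hp] with q hq using indicator_of_mem hq g
  have hout : ∀ p ∉ D, D.indicator g =ᶠ[𝓝 p] fun _ => 0 := fun p hp => by
    filter_upwards [hK.isClosed.isOpen_compl.mem_nhds fun h => hp (hKD h)] with q hq using hz q hq
  refine ⟨contDiff_iff_contDiffAt.2 fun p => ?_, HasCompactSupport.intro hK hz,
    fun p hp => (hin p hp).fderiv_eq, fun p hp => ?_⟩
  · by_cases hp : p ∈ D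
    · exact (hg p hp).congr_of_eventuallyEq (hin p hp)
    · exact contDiffAt_const.congr_of_eventuallyEq (hout p hp)
  · rw [(hout p hp).fderiv_eq, fderiv_fun_const]
    rfl

theorem HasCompactSupport.comp_prodMk {Y : Type*} [Zero Y] {G : ℝ × E2 → Y}
    (hG : HasCompactSupport G) (t : ℝ) : HasCompactSupport fun y => G (t, y) :=
  hG.comp_isClosedEmbedding
    (Isometry.isClosedEmbedding (f := fun y : E2 => (t, y)) (by
      intro a b; simp [Prod.edist_eq]))

theorem integral_fderiv_planeDir_eq_zero {G : ℝ × E2 → ℝ} (hG : ContDiff ℝ 1 G)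
    (hGc : HasCompactSupport G) (t : ℝ) (k : Fin 2) :
    ∫ y, fderiv ℝ G (t, y) (planeDir k) = 0 := by
  set g : E2 → ℝ := fun y => G (t, y)
  have hg : ContDiff ℝ 1 g := hG.comp (contDiff_const.prodMk contDiff_id)
  have hgc : HasCompactSupport g := hGc.comp_prodMk t
  have hfd : ∀ y, fderiv ℝ G (t, y) (planeDir k) = fderiv ℝ g y (EuclideanSpace.single k 1) := by
    intro y
    have h1 := HasFDerivAt.comp (g := G) y
      ((hG.differentiable one_ne_zero (t, y)).hasFDerivAt) (hasFDerivAt_prodMk_right t y)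
    have h2 : fderiv ℝ g y = _ := h1.fderiv
    rw [h2]
    rfl
  simp_rw [hfd]
  have hint : Integrable fun y => fderiv ℝ g y (EuclideanSpace.single k 1) :=
    Continuous.integrable_of_hasCompactSupport
      ((hg.continuous_fderiv one_ne_zero).clm_apply continuous_const)
      ((hgc.fderiv ℝ).comp_left (g := fun A : E2 →L[ℝ] ℝ => A (EuclideanSpace.single k 1)) rfl)
  -- Integration by parts against the constant 1.
  have := integral_mul_fderiv_eq_neg_fderiv_mul_of_integrable (μ := (volume : Measure E2))
    (f := fun _ : E2 => (1 : ℝ)) (g := g) (v := EuclideanSpace.single k 1) (by simp)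
    (by simpa using hint)
    (by simpa using hg.continuous.integrable_of_hasCompactSupport hgc)
    (fun x _ => differentiableAt_const _) (fun x _ => hg.differentiable one_ne_zero x)
  simpa using this

theorem hasDerivAt_integral_slice {G : ℝ × E2 → ℝ} (hG : ContDiff ℝ 1 G)
    (hGc : HasCompactSupport G) (t : ℝ) :
    HasDerivAt (fun s => ∫ y, G (s, y)) (∫ y, fderiv ℝ G (t, y) (1, 0)) t := by
  have hcont : Continuous (fderiv ℝ G) := hG.continuous_fderiv one_ne_zero
  have hsupp : HasCompactSupport (fderiv ℝ G) := hGc.fderiv ℝ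
  have hc1 : Continuous fun p => fderiv ℝ G p (1, 0) := hcont.clm_apply continuous_const
  have hs1 : HasCompactSupport fun p => fderiv ℝ G p (1, 0) :=
    hsupp.comp_left (g := fun A : ℝ × E2 →L[ℝ] ℝ => A (1, 0)) rfl
  obtain ⟨C, hC⟩ := hc1.bounded_above_of_compact_support hs1
  -- The planar shadow of the support yields one dominating function `C · 1_K` for all times.
  set K : Set E2 := Prod.snd '' tsupport fun p => fderiv ℝ G p (1, 0) with hK
  have hKc : IsCompact K := hs1.isCompact.image continuous_snd
  have hsl : ∀ s : ℝ, Continuous fun y : E2 => (s, y) := fun s => by fun_prop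
  refine (hasDerivAt_integral_of_dominated_loc_of_deriv_le (F := fun s y => G (s, y))
    (F' := fun s y => fderiv ℝ G (s, y) (1, 0)) (bound := K.indicator fun _ => C)
    (s := univ) univ_mem ?_ ?_ ?_ ?_ ?_ ?_).2
  · exact Eventually.of_forall fun s => (hG.continuous.comp (hsl s)).aestronglyMeasurable
  · exact (hG.continuous.comp (hsl t)).integrable_of_hasCompactSupport (hGc.comp_prodMk t)
  · exact (hc1.comp (hsl t)).aestronglyMeasurable
  · refine Eventually.of_forall fun y s _ => ?_
    by_cases hy : y ∈ K
    · rw [indicator_of_mem hy]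
      exact hC _
    · rw [indicator_of_notMem hy, image_eq_zero_of_notMem_tsupport
        (f := fun p => fderiv ℝ G p (1, 0)) fun h => hy ⟨_, h, rfl⟩, norm_zero]
  · rw [integrable_indicator_iff hKc.measurableSet]
    exact integrableOn_const hKc.measure_ne_top
  · refine Eventually.of_forall fun y s _ => ?_
    have h1 : HasDerivAt (fun s : ℝ => (s, y)) ((1 : ℝ), (0 : E2)) s :=
      (hasDerivAt_id s).prodMk (hasDerivAt_const s y)
    exact HasFDerivAt.comp_hasDerivAt (l := G) s
      ((hG.differentiable one_ne_zero (s, y)).hasFDerivAt) h1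

theorem IsMovingClosedSurface.isCompact_slice {T : ℝ} {Γ : ℝ → Set E3} {ν : ℝ → E3 → E3}
    (hΓ : IsMovingClosedSurface T Γ ν) {t : ℝ} (ht : t ∈ Icc 0 T) : IsCompact (Γ t) := by
  have h1 : IsCompact (spaceTime (Icc 0 T) Γ ∩ Prod.fst ⁻¹' {t}) :=
    hΓ.isCompact.inter_right (isClosed_singleton.preimage continuous_fst)
  convert h1.image continuous_snd using 1
  ext x
  constructor
  · intro hx
    exact ⟨(t, x), ⟨⟨ht, hx⟩, rfl⟩, rfl⟩
  · rintro ⟨⟨s, y⟩, ⟨⟨-, hy⟩, hs⟩, rfl⟩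
    obtain rfl : s = t := hs
    exact hy

/-! ### Surface integrals and transport in a chart -/

namespace IsGraphChart

variable {T : ℝ} {Γ : ℝ → Set E3} {ν : ℝ → E3 → E3} {e : OrthonormalBasis (Fin 3) ℝ E3}
  {N : Set (ℝ × E3)} {D : Set (ℝ × E2)} {h : ℝ × E2 → ℝ}

theorem injective_graphDeriv_slice (p : ℝ × E2) :
    Function.Injective ((graphDeriv e h p).comp (ContinuousLinearMap.inr ℝ ℝ E2)) := by
  intro a b hab
  have h1 : graphDeriv e h p (0, a) = graphDeriv e h p (0, b) := hab
  have h2 := congrArg (planeProj e) h1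
  rwa [graphDeriv_apply, graphDeriv_apply, planeProj_planeEmb_add, planeProj_planeEmb_add] at h2

/-- The square is the Gram determinant of the two tangent vectors `e k.castSucc + slope2 h k p • e
2`. -/
theorem normDet_graphDeriv_slice (p : ℝ × E2) :
    ((graphDeriv e h p).comp (ContinuousLinearMap.inr ℝ ℝ E2)).normDet = areaDensity h p := by
  have h1 := LinearMap.normDet_sq_eq_det_gram
    (((graphDeriv e h p).comp (ContinuousLinearMap.inr ℝ ℝ E2) : E2 →L[ℝ] E3) : E2 →ₗ[ℝ] E3)
    (EuclideanSpace.basisFun (Fin 2) ℝ)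
  have hv : ∀ k : Fin 2, (((graphDeriv e h p).comp (ContinuousLinearMap.inr ℝ ℝ E2) : E2 →L[ℝ] E3) :
      E2 →ₗ[ℝ] E3) (EuclideanSpace.basisFun (Fin 2) ℝ k) = e k.castSucc + slope2 h k p • e 2 := by
    intro k
    have : graphDeriv e h p (planeDir k) = e k.castSucc + slope2 h k p • e 2 := by
      rw [graphDeriv_apply]
      congr 1
      fin_cases k <;> simp [planeDir, planeEmb_apply]
    rw [← this]
    simp [planeDir]
  rw [areaDensity, eq_comm, Real.sqrt_eq_iff_mul_self_eq (by positivity) (LinearMap.normDet_nonneg _),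
    ← sq]
  refine Eq.symm (h1.trans ?_)
  rw [Matrix.det_fin_two]
  simp only [Matrix.gram_apply, hv, inner_add_left, inner_add_right, inner_smul_left,
    inner_smul_right, inner_frame]
  simp
  ring

/-- Integration over the part of `Γ s` in a graph chart. -/
theorem setIntegral_eq (hΓ : IsMovingClosedSurface T Γ ν) (hc : IsGraphChart T Γ ν e N D h)
    {s : ℝ} (hs : s ∈ Ioo 0 T) {g : E3 → ℝ} {k : E2 → ℝ} (hg : ∀ x ∈ Γ s, (s, x) ∉ N → g x = 0)
    (hk : Continuous k) (hkc : HasCompactSupport k)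
    (hkD : ∀ y, (s, y) ∈ D → k y = areaDensity h (s, y) * g (graphMap e h (s, y)))
    (hk0 : ∀ y, (s, y) ∉ D → k y = 0) :
    IntegrableOn g (Γ s) μHE[2] ∧ ∫ x in Γ s, g x ∂μHE[2] = ∫ y, k y := by
  set Ω : Set E2 := {y | (s, y) ∈ D} with hΩ
  have hΩo : IsOpen Ω := hc.isOpen_target.preimage (by fun_prop)
  set ψ : E2 → E3 := fun y => graphMap e h (s, y) with hψ
  set S : Set E3 := ψ '' Ω with hS
  have hΓm : MeasurableSet (Γ s) := (hΓ.isCompact_slice (Ioo_subset_Icc_self hs)).measurableSet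
  have hSeq : S = Γ s ∩ {x | (s, x) ∈ N} := by
    ext x
    constructor
    · rintro ⟨y, hy, rfl⟩
      exact ⟨(hc.map_mem _ hy).2, (hc.map_mem _ hy).1⟩
    · rintro ⟨hx, hxN⟩
      exact ⟨planeProj e x, (hc.proj_mem s x hxN hx).1, (hc.proj_mem s x hxN hx).2⟩
  have hSΓ : S ⊆ Γ s := hSeq ▸ inter_subset_left
  have hSm : MeasurableSet S := by
    rw [hSeq]
    exact hΓm.inter (hc.isOpen_source.preimage (by fun_prop : Continuous fun x : E3 => (s, x))).measurableSet
  have hg0 : ∀ x ∈ Γ s \ S, g x = 0 := by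
    rintro x ⟨hx, hxS⟩
    refine hg x hx fun hxN => hxS ?_
    rw [hSeq]
    exact ⟨hx, hxN⟩
  have hWc : ContinuousOn (fun y => areaDensity h (s, y)) Ω := fun y hy =>
    ((hc.contDiffAt_areaDensity hy).continuousAt.comp
      (f := fun y : E2 => (s, y)) (by fun_prop)).continuousWithinAt
  have harea : (μHE[2].restrict S).map (planeProj e) =
      (volume.restrict Ω).withDensity fun y => ENNReal.ofReal (areaDensity h (s, y)) := by
    have := map_restrict_euclideanHausdorffMeasure_image (U := E2) (V := E3) (ψ := ψ)
      (ψ' := fun y => (graphDeriv e h (s, y)).comp (ContinuousLinearMap.inr ℝ ℝ E2))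
      (π := planeProj e) (J := fun y => areaDensity h (s, y)) hΩo (fun y hy => ?_)
      (fun y _ => injective_graphDeriv_slice _) (fun y _ => normDet_graphDeriv_slice _) hWc
      (planeProj e).continuous (fun y _ => planeProj_graphMap e h (s, y))
    · rwa [finrank_euclideanSpace_fin] at this
    · have h1 : ContDiffAt ℝ ∞ ψ y := (hc.contDiffAt_graphMap hy).comp y
        (contDiffAt_const.prodMk contDiffAt_id)
      have h2 : HasFDerivAt ψ ((graphDeriv e h (s, y)).comp (ContinuousLinearMap.inr ℝ ℝ E2)) y :=
        HasFDerivAt.comp (g := graphMap e h) y (hc.hasFDerivAt_graphMap hy)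
          (hasFDerivAt_prodMk_right s y)
      exact h1.hasStrictFDerivAt' h2 (by simp)
  -- Nothing is assumed on the regularity of `g`; it is recovered in the chart as the quotient of
  -- the continuous `k` by the area density.
  have hgψ : ContinuousOn (fun y => g (ψ y)) Ω := by
    refine (hk.continuousOn.div hWc fun y _ => (areaDensity_pos h _).ne').congr fun y hy => ?_
    simp only [Pi.div_apply]
    rw [hkD y hy, mul_div_cancel_left₀ _ (areaDensity_pos h _).ne']
  have hmeas : AEStronglyMeasurable (fun y => g (ψ y)) ((μHE[2].restrict S).map (planeProj e)) := by
    rw [harea]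
    exact (hgψ.aestronglyMeasurable hΩo.measurableSet).mono_ac (withDensity_absolutelyContinuous _ _)
  have hWm : AEMeasurable (fun y => ENNReal.ofReal (areaDensity h (s, y))) (volume.restrict Ω) :=
    (hWc.aemeasurable hΩo.measurableSet).ennreal_ofReal
  have hfin : ∀ᵐ y ∂(volume.restrict Ω), ENNReal.ofReal (areaDensity h (s, y)) < ⊤ :=
    Eventually.of_forall fun _ => ENNReal.ofReal_lt_top
  have hcongr : ∀ x ∈ S, g (ψ (planeProj e x)) = g x := by
    rintro _ ⟨y, -, rfl⟩
    rw [show planeProj e (ψ y) = y from planeProj_graphMap e h (s, y)]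
  have hkΩ : ∀ y ∈ Ω, (ENNReal.ofReal (areaDensity h (s, y))).toReal • g (ψ y) = k y := by
    intro y hy
    rw [ENNReal.toReal_ofReal (areaDensity_pos h _).le, hkD y hy, smul_eq_mul]
  have hki : Integrable k := hk.integrable_of_hasCompactSupport hkc
  constructor
  · refine IntegrableOn.of_forall_sdiff_eq_zero (s := S) ?_ hΓm hg0
    have h1 : IntegrableOn (fun x => g (ψ (planeProj e x))) S μHE[2] := by
      refine (integrable_map_measure hmeas (planeProj e).continuous.aemeasurable).1 ?_
      rw [harea, integrable_withDensity_iff_integrable_smul₀' hWm hfin]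
      exact (integrableOn_congr_fun hkΩ hΩo.measurableSet).2 hki.integrableOn
    exact (integrableOn_congr_fun hcongr hSm).1 h1
  · rw [setIntegral_eq_of_subset_of_forall_sdiff_eq_zero hΓm hSΓ hg0,
      ← setIntegral_congr_fun hSm hcongr,
      ← integral_map (planeProj e).continuous.aemeasurable hmeas, harea,
      integral_withDensity_eq_integral_toReal_smul₀ hWm hfin,
      setIntegral_congr_fun hΩo.measurableSet hkΩ]
    refine setIntegral_eq_integral_of_forall_compl_eq_zero fun y hy => hk0 y hy

/-- The transport theorem for fields that are cut off to a graph chart. -/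
theorem hasDerivAt_setIntegral (hΓ : IsMovingClosedSurface T Γ ν)
    (hc : IsGraphChart T Γ ν e N D h) {F : ℝ → E3 → ℝ} {w : ℝ → E3 → E3} {χ : ℝ × E3 → ℝ}
    (hF : ContDiffOn ℝ 1 (Function.uncurry F) (spaceTime (Ioo 0 T) Γ))
    (hw : ContDiffOn ℝ 1 (Function.uncurry w) (spaceTime (Ioo 0 T) Γ))
    (hwν : ∀ s ∈ Ioo 0 T, ∀ y ∈ Γ s, IsNormalVelocityAt Γ ν s y (inner ℝ (w s y) (ν s y)))
    (hχ : ContDiff ℝ 1 χ) (hχc : HasCompactSupport χ) (hχN : tsupport χ ⊆ N)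
    {t : ℝ} (ht : t ∈ Ioo 0 T) :
    IntegrableOn (fun x => χ (t, x) * F t x) (Γ t) μHE[2] ∧
    IntegrableOn (fun x => χ (t, x) * (scalarMaterialDeriv T Γ w F t x +
      F t x * surfDiv (Γ t) (ν t) (w t) x) + F t x * fderiv ℝ χ (t, x) (1, w t x)) (Γ t) μHE[2] ∧
    HasDerivAt (fun s => ∫ x in Γ s, χ (s, x) * F s x ∂μHE[2])
      (∫ x in Γ t, (χ (t, x) * (scalarMaterialDeriv T Γ w F t x +
        F t x * surfDiv (Γ t) (ν t) (w t) x) + F t x * fderiv ℝ χ (t, x) (1, w t x)) ∂μHE[2]) t := by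
  set a : ℝ × E2 → ℝ := fun p => χ (p.1, graphMap e h p) with ha
  set f := graphPullback e h F with hf
  set W := areaDensity h with hW
  set u : Fin 2 → ℝ × E2 → ℝ := fun k p => planeProj e (graphPullback e h w p) k with hu
  -- The part of the surface in the support of `χ`, in chart coordinates. The closed time interval
  -- gives compactness; `tsupport χ ⊆ N` keeps the set inside `D`.
  set K : Set (ℝ × E2) := (fun q : ℝ × E3 => (q.1, planeProj e q.2)) ''
    (tsupport χ ∩ spaceTime (Icc 0 T) Γ) with hK
  have hKc : IsCompact K := (hχc.isCompact.inter_right hΓ.isCompact.isClosed).image (by fun_prop)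
  have hKD : K ⊆ D := by
    rintro _ ⟨⟨s, x⟩, ⟨h1, h2⟩, rfl⟩
    exact (hc.proj_mem s x (hχN h1) h2.2).1
  have ha0 : ∀ p ∈ D, p ∉ K → a p = 0 := by
    intro p hp hpK
    by_contra hne
    refine hpK ⟨(p.1, graphMap e h p), ⟨subset_tsupport _ hne,
      Ioo_subset_Icc_self (hc.graph_mem_spaceTime hp).1, (hc.map_mem p hp).2⟩, ?_⟩
    simp [planeProj_graphMap]
  have hac : ∀ p ∈ D, ContDiffAt ℝ 1 a p := fun p hp =>
    hχ.contDiffAt.comp p (contDiffAt_fst.prodMk ((hc.contDiffAt_graphMap hp).of_le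
      (by exact WithTop.coe_le_coe.2 le_top)))
  have hfc : ∀ p ∈ D, ContDiffAt ℝ 1 f p := fun p hp => hc.contDiffAt_pullback hF hp
  have hWc : ∀ p ∈ D, ContDiffAt ℝ 1 W p := fun p hp => hc.contDiffAt_areaDensity hp
  have huc : ∀ k, ∀ p ∈ D, ContDiffAt ℝ 1 (u k) p := by
    intro k p hp
    have h1 := hc.contDiffAt_pullback hw hp
    exact ContDiffAt.comp (g := innerSL ℝ (e k.castSucc)) p
      (innerSL ℝ (e k.castSucc)).contDiff.contDiffAt h1
  set G : ℝ × E2 → ℝ := fun p => W p * (a p * f p) with hG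
  have hGc : ∀ p ∈ D, ContDiffAt ℝ 1 G p := fun p hp => (hWc p hp).mul ((hac p hp).mul (hfc p hp))
  obtain ⟨hG1, hG2, hG3, hG4⟩ := contDiff_indicator_of_compact (g := G) hKc hc.isOpen_target hKD hGc
    fun p hp hpK => by simp [hG, ha0 p hp hpK]
  have hGu : ∀ k, _ := fun k => contDiff_indicator_of_compact (g := fun p => G p * u k p) hKc
    hc.isOpen_target hKD (fun p hp => (hGc p hp).mul (huc k p hp))
    fun p hp hpK => by simp [hG, ha0 p hp hpK]
  -- The space-time divergence ∂ₜG + div(Gu), extended by zero.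
  set R : ℝ × E2 → ℝ := fun p => fderiv ℝ (D.indicator G) p (1, 0) +
    ∑ k, fderiv ℝ (D.indicator fun p => G p * u k p) p (planeDir k) with hR
  have hRcont : Continuous R := by
    refine ((hG1.continuous_fderiv one_ne_zero).clm_apply continuous_const).add
      (continuous_finsetSum _ fun k _ =>
        ((hGu k).1.continuous_fderiv one_ne_zero).clm_apply continuous_const)
  have hRz : ∀ p ∉ D, R p = 0 := by
    intro p hp
    simp [hR, hG4 p hp, fun k => (hGu k).2.2.2 p hp]
  have hRsupp : HasCompactSupport R := by
    refine HasCompactSupport.add ?_ ?_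
    · exact (hG2.fderiv ℝ).comp_left (g := fun A : ℝ × E2 →L[ℝ] ℝ => A (1, 0)) rfl
    · simp only [Fin.sum_univ_two]
      exact (((hGu 0).2.1.fderiv ℝ).comp_left
        (g := fun A : ℝ × E2 →L[ℝ] ℝ => A (planeDir 0)) rfl).add
        (((hGu 1).2.1.fderiv ℝ).comp_left (g := fun A : ℝ × E2 →L[ℝ] ℝ => A (planeDir 1)) rfl)
  have hRD : ∀ p ∈ D, R p = W p * (a p * (scalarMaterialDeriv T Γ w F p.1 (graphMap e h p) +
      F p.1 (graphMap e h p) * surfDiv (Γ p.1) (ν p.1) (w p.1) (graphMap e h p)) +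
      F p.1 (graphMap e h p) * fderiv ℝ χ (p.1, graphMap e h p) (1, w p.1 (graphMap e h p))) := by
    intro p hp
    obtain ⟨hps, hpx⟩ := hc.graph_mem_spaceTime hp
    have hda := ((hac p hp).differentiableAt one_ne_zero).hasFDerivAt
    have hdf := ((hfc p hp).differentiableAt one_ne_zero).hasFDerivAt
    have hdW := ((hWc p hp).differentiableAt one_ne_zero).hasFDerivAt
    have hdu := fun k => ((huc k p hp).differentiableAt one_ne_zero).hasFDerivAt
    have hdG : HasFDerivAt G _ p := hdW.mul (hda.mul hdf)
    have hdGu : ∀ k, HasFDerivAt (fun p => G p * u k p) _ p := fun k => hdG.mul (hdu k)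
    set Y : ℝ × E2 := (1, planeProj e (graphPullback e h w p)) with hY
    have hYw : graphDeriv e h p Y = w p.1 (graphMap e h p) :=
      hc.graphDeriv_of_isNormalVelocityAt hΓ hp (hwν _ hps _ hpx)
    have hYd : Y = (1, 0) + (u 0 p • planeDir 0 + u 1 p • planeDir 1) := by
      rw [← planeDir_decomp]
      simp [hY]
    have hfY : fderiv ℝ f p Y = scalarMaterialDeriv T Γ w F p.1 (graphMap e h p) := by
      rw [hf, hc.fderiv_pullback hF hp, hYw]
      rfl
    have haY : fderiv ℝ a p Y =
        fderiv ℝ χ (p.1, graphMap e h p) (1, w p.1 (graphMap e h p)) := by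
      have h1 : HasFDerivAt (fun q : ℝ × E2 => (q.1, graphMap e h q))
          ((ContinuousLinearMap.fst ℝ ℝ E2).prod (graphDeriv e h p)) p :=
        hasFDerivAt_fst.prodMk (hc.hasFDerivAt_graphMap hp)
      have h2 := HasFDerivAt.comp (g := χ) p
        (hχ.differentiable one_ne_zero (p.1, graphMap e h p)).hasFDerivAt h1
      have h3 : fderiv ℝ a p = _ := h2.fderiv
      rw [h3, ← hYw]
      rfl
    have hdiv := hc.surfDiv_eq_coord hΓ hw hwν hp
    rw [Fin.sum_univ_two] at hdiv
    change W p * _ = fderiv ℝ W p Y + W p * (fderiv ℝ (u 0) p (planeDir 0) +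
      fderiv ℝ (u 1) p (planeDir 1)) at hdiv
    have hfval : f p = F p.1 (graphMap e h p) := rfl
    rw [← hfY, ← haY, ← hfval]
    have hWY := congrArg (fderiv ℝ W p) hYd
    have hfY' := congrArg (fderiv ℝ f p) hYd
    have haY' := congrArg (fderiv ℝ a p) hYd
    simp only [map_add, map_smul, smul_eq_mul] at hWY hfY' haY'
    rw [hWY] at hdiv
    simp only [hR, Fin.sum_univ_two]
    rw [hG3 p hp, (hGu 0).2.2.1 p hp, (hGu 1).2.2.1 p hp, hdG.fderiv, (hdGu 0).fderiv,
      (hdGu 1).fderiv, hfY', haY']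
    simp only [hG, add_apply, smul_apply, smul_eq_mul]
    -- After the product rule only a f (DW(Y) + W div u) remains to be matched, which is the
    -- coordinate formula for the surface divergence.
    linear_combination (-(a p * f p)) * hdiv
  have hsl : ∀ s : ℝ, Continuous fun y : E2 => (s, y) := fun s => by fun_prop
  have hχ0 : ∀ s x, (s, x) ∉ N → χ (s, x) = 0 := fun s x hx =>
    image_eq_zero_of_notMem_tsupport fun h => hx (hχN h)
  have hint : ∀ s ∈ Ioo 0 T, _ := fun s hs => hc.setIntegral_eq hΓ hs
    (g := fun x => χ (s, x) * F s x) (k := fun y => D.indicator G (s, y))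
    (fun x _ hxN => by simp [hχ0 s x hxN]) (hG1.continuous.comp (hsl s)) (hG2.comp_prodMk s)
    (fun y hy => by rw [indicator_of_mem hy]; rfl) (fun y hy => indicator_of_notMem hy G)
  have hint2 := hc.setIntegral_eq hΓ ht (k := fun y => R (t, y))
    (g := fun x => χ (t, x) * (scalarMaterialDeriv T Γ w F t x +
      F t x * surfDiv (Γ t) (ν t) (w t) x) + F t x * fderiv ℝ χ (t, x) (1, w t x))
    (fun x _ hxN => by
      have h1 : fderiv ℝ χ (t, x) = 0 :=
        image_eq_zero_of_notMem_tsupport fun h => hxN (hχN (tsupport_fderiv_subset ℝ h))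
      simp [hχ0 t x hxN, h1]) (hRcont.comp (hsl t)) (hRsupp.comp_prodMk t)
    (fun y hy => hRD _ hy) (fun y hy => hRz _ hy)
  refine ⟨(hint t ht).1, hint2.1, ?_⟩
  rw [hint2.2]
  have hder := hasDerivAt_integral_slice hG1 hG2 t
  have hRint : ∫ y, R (t, y) = ∫ y, fderiv ℝ (D.indicator G) (t, y) (1, 0) := by
    have hi0 : Integrable fun y => fderiv ℝ (D.indicator G) (t, y) (1, 0) :=
      Continuous.integrable_of_hasCompactSupport
        (((hG1.continuous_fderiv one_ne_zero).clm_apply continuous_const).comp (hsl t))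
        (((hG2.fderiv ℝ).comp_left
          (g := fun A : ℝ × E2 →L[ℝ] ℝ => A (1, 0)) rfl).comp_prodMk t)
    have hik : ∀ k, Integrable fun y =>
        fderiv ℝ (D.indicator fun p => G p * u k p) (t, y) (planeDir k) := fun k =>
      Continuous.integrable_of_hasCompactSupport
        ((((hGu k).1.continuous_fderiv one_ne_zero).clm_apply continuous_const).comp (hsl t))
        ((((hGu k).2.1.fderiv ℝ).comp_left
          (g := fun A : ℝ × E2 →L[ℝ] ℝ => A (planeDir k)) rfl).comp_prodMk t)
    simp only [hR]
    rw [integral_add hi0 (integrable_finsetSum _ fun k _ => hik k),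
      integral_finsetSum _ fun k _ => hik k]
    rw [Finset.sum_eq_zero fun k _ => integral_fderiv_planeDir_eq_zero (hGu k).1 (hGu k).2.1 t k,
      add_zero]
  rw [hRint]
  refine hder.congr_of_eventuallyEq ?_
  filter_upwards [isOpen_Ioo.mem_nhds ht] with s hs using (hint s hs).2

end IsGraphChart

/-! ### Partition of unity and the global transport theorem -/

-- The sum must be 1 on a neighborhood of `K`, so that the derivatives of the cut-offs add up to
-- zero on `K`; hence the partition is taken on a closed thickening. Intersecting with unit balls
-- makes the supports compact.
open scoped Manifold in
theorem IsCompact.exists_contDiff_partition {E : Type} [NormedAddCommGroup E] [NormedSpace ℝ E]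
    [FiniteDimensional ℝ E] {K : Set E} (hK : IsCompact K) {N : K → Set E}
    (hN : ∀ p, IsOpen (N p)) (hpN : ∀ p : K, (p : E) ∈ N p) :
    ∃ (ι : Type) (_ : Fintype ι) (χ : ι → E → ℝ) (idx : ι → K),
      (∀ i, ContDiff ℝ 1 (χ i) ∧ HasCompactSupport (χ i) ∧ tsupport (χ i) ⊆ N (idx i)) ∧
      ∃ O : Set E, IsOpen O ∧ K ⊆ O ∧ ∀ p ∈ O, ∑ i, χ i p = 1 := by
  have : ProperSpace E := FiniteDimensional.proper ℝ E
  set U : K → Set E := fun p => N p ∩ Metric.ball p 1 with hU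
  have hUo : ∀ p, IsOpen (U p) := fun p => (hN p).inter Metric.isOpen_ball
  obtain ⟨I, hI⟩ := hK.elim_finite_subcover U hUo fun p hp =>
    mem_iUnion.2 ⟨⟨p, hp⟩, hpN ⟨p, hp⟩, Metric.mem_ball_self one_pos⟩
  obtain ⟨δ, hδ, hδU⟩ := hK.exists_cthickening_subset_open
    (isOpen_biUnion fun i (_ : i ∈ I) => hUo i) hI
  obtain ⟨f, hf⟩ := SmoothPartitionOfUnity.exists_isSubordinate 𝓘(ℝ, E)
    (Metric.isClosed_cthickening (δ := δ) (E := K)) (fun i : I => U i) (fun i => hUo i)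
    (hδU.trans fun x hx => by simpa using hx)
  refine ⟨I, inferInstance, fun i => f i, fun i => i, fun i => ⟨?_, ?_, ?_⟩,
    Metric.thickening δ K, Metric.isOpen_thickening, Metric.self_subset_thickening hδ K,
    fun p hp => ?_⟩
  · exact (f i).contMDiff.contDiff.of_le (by exact WithTop.coe_le_coe.2 le_top)
  · refine Metric.isCompact_of_isClosed_isBounded (isClosed_tsupport _) ?_
    exact Metric.isBounded_ball.subset ((hf i).trans inter_subset_right)
  · exact (hf i).trans inter_subset_left
  · rw [← finsum_eq_sum_of_fintype]
    exact f.sum_eq_one (Metric.thickening_subset_cthickening δ K hp)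

section transport

variable {T : ℝ} {Γ : ℝ → Set E3} {ν : ℝ → E3 → E3}

/-- The **transport theorem** on a moving closed surface. -/
theorem IsMovingClosedSurface.hasDerivAt_setIntegral (hΓ : IsMovingClosedSurface T Γ ν)
    {F : ℝ → E3 → ℝ} {w : ℝ → E3 → E3}
    (hF : ContDiffOn ℝ 1 (Function.uncurry F) (spaceTime (Ioo 0 T) Γ))
    (hw : ContDiffOn ℝ 1 (Function.uncurry w) (spaceTime (Ioo 0 T) Γ))
    (hwν : ∀ s ∈ Ioo 0 T, ∀ y ∈ Γ s, IsNormalVelocityAt Γ ν s y (inner ℝ (w s y) (ν s y)))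
    {t : ℝ} (ht : t ∈ Ioo 0 T) :
    IntegrableOn (F t) (Γ t) μHE[2] ∧
    IntegrableOn (fun x => scalarMaterialDeriv T Γ w F t x +
      F t x * surfDiv (Γ t) (ν t) (w t) x) (Γ t) μHE[2] ∧
    HasDerivAt (fun s => ∫ x in Γ s, F s x ∂μHE[2])
      (∫ x in Γ t, (scalarMaterialDeriv T Γ w F t x +
        F t x * surfDiv (Γ t) (ν t) (w t) x) ∂μHE[2]) t := by
  -- Charts are available only over the open interval `(0, T)`, so a compact `[a, b]` around `t` is
  -- chosen inside it.
  obtain ⟨a, ha0, hat⟩ := exists_between ht.1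
  obtain ⟨b, htb, hbT⟩ := exists_between ht.2
  have hsub : Icc a b ⊆ Ioo 0 T := fun s hs => ⟨ha0.trans_le hs.1, hs.2.trans_lt hbT⟩
  set K := spaceTime (Icc a b) Γ with hKdef
  have hK : IsCompact K := by
    have h1 : IsCompact (spaceTime (Icc 0 T) Γ ∩ Prod.fst ⁻¹' Icc a b) :=
      hΓ.isCompact.inter_right (isClosed_Icc.preimage continuous_fst)
    convert h1 using 1
    ext p
    exact ⟨fun hp => ⟨⟨Ioo_subset_Icc_self (hsub hp.1), hp.2⟩, hp.1⟩, fun hp => ⟨hp.2, hp.1.2⟩⟩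
  have hch : ∀ p : K, ∃ N : Set (ℝ × E3), (p : ℝ × E3) ∈ N ∧
      ∃ (e : OrthonormalBasis (Fin 3) ℝ E3) (D : Set (ℝ × E2)) (h : ℝ × E2 → ℝ),
        IsGraphChart T Γ ν e N D h := by
    rintro ⟨⟨s, x⟩, hs, hx⟩
    obtain ⟨e, N, D, h, hc, hN⟩ := hΓ.exists_isGraphChart (hsub hs) hx
    exact ⟨N, hN, e, D, h, hc⟩
  choose N hpN e D h hc using hch
  obtain ⟨ι, _, χ, idx, hχ, O, hO, hKO, hsum⟩ := hK.exists_contDiff_partition (N := N)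
    (fun p => (hc p).isOpen_source) hpN
  have hloc := fun i => (hc (idx i)).hasDerivAt_setIntegral hΓ hF hw hwν
    (hχ i).1 (hχ i).2.1 (hχ i).2.2 ht
  have hΓm : ∀ s ∈ Ioo 0 T, MeasurableSet (Γ s) := fun s hs =>
    (hΓ.isCompact_slice (Ioo_subset_Icc_self hs)).measurableSet
  have hS : ∀ s ∈ Icc a b, ∀ x ∈ Γ s, ∑ i, χ i (s, x) * F s x = F s x := by
    intro s hs x hx
    rw [← Finset.sum_mul, hsum _ (hKO ⟨hs, hx⟩), one_mul]
  have htab : t ∈ Icc a b := ⟨hat.le, htb.le⟩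
  have hS' : ∀ x ∈ Γ t, ∑ i, (χ i (t, x) * (scalarMaterialDeriv T Γ w F t x +
      F t x * surfDiv (Γ t) (ν t) (w t) x) + F t x * fderiv ℝ (χ i) (t, x) (1, w t x)) =
      scalarMaterialDeriv T Γ w F t x + F t x * surfDiv (Γ t) (ν t) (w t) x := by
    intro x hx
    have hmem : (t, x) ∈ O := hKO ⟨htab, hx⟩
    have hd : ∑ i, fderiv ℝ (χ i) (t, x) = 0 := by
      have h1 : HasFDerivAt (fun p => ∑ i, χ i p) (∑ i, fderiv ℝ (χ i) (t, x)) (t, x) :=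
        HasFDerivAt.fun_sum fun i _ => ((hχ i).1.differentiable one_ne_zero _).hasFDerivAt
      refine h1.unique ((hasFDerivAt_const (1 : ℝ) (t, x)).congr_of_eventuallyEq ?_)
      filter_upwards [hO.mem_nhds hmem] with p hp using hsum p hp
    have hd' := congrArg (fun A : ℝ × E3 →L[ℝ] ℝ => A (1, w t x)) hd
    simp only [sum_apply, zero_apply] at hd'
    rw [Finset.sum_add_distrib, ← Finset.sum_mul, ← Finset.mul_sum, hsum _ hmem, hd']
    ring
  refine ⟨?_, ?_, ?_⟩
  · refine (integrableOn_congr_fun (hS t htab) (hΓm t ht)).1 ?_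
    exact integrable_finsetSum _ fun i _ => (hloc i).1
  · refine (integrableOn_congr_fun hS' (hΓm t ht)).1 ?_
    exact integrable_finsetSum _ fun i _ => (hloc i).2.1
  · rw [← setIntegral_congr_fun (hΓm t ht) hS', integral_finsetSum _ fun i _ => (hloc i).2.1]
    refine (HasDerivAt.fun_sum fun i _ => (hloc i).2.2).congr_of_eventuallyEq ?_
    filter_upwards [isOpen_Ioo.mem_nhds (⟨hat, htb⟩ : t ∈ Ioo a b)] with s hs
    have hs' := Ioo_subset_Icc_self hs
    rw [← setIntegral_congr_fun (hΓm s (hsub hs')) (hS s hs'), integral_finsetSum]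
    intro i _
    exact ((hc (idx i)).hasDerivAt_setIntegral hΓ hF hw hwν
      (hχ i).1 (hχ i).2.1 (hχ i).2.2 (hsub hs')).1

/-! ### Pointwise identities for the energy balance -/

theorem IsMovingClosedSurface.exists_graph_point (hΓ : IsMovingClosedSurface T Γ ν)
    {t : ℝ} (ht : t ∈ Ioo 0 T) {y : E3} (hy : y ∈ Γ t) :
    ∃ (e : OrthonormalBasis (Fin 3) ℝ E3) (N : Set (ℝ × E3)) (D : Set (ℝ × E2)) (h : ℝ × E2 → ℝ),
      IsGraphChart T Γ ν e N D h ∧ ∃ z, (t, z) ∈ D ∧ graphMap e h (t, z) = y := by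
  obtain ⟨e, N, D, h, hc, hN⟩ := hΓ.exists_isGraphChart ht hy
  exact ⟨e, N, D, h, hc, planeProj e y, hc.proj_mem t y hN hy⟩

theorem scalarMaterialDeriv_half_norm_sq (hΓ : IsMovingClosedSurface T Γ ν) {v w : ℝ → E3 → E3}
    (hv : ContDiffOn ℝ 1 (Function.uncurry v) (spaceTime (Ioo 0 T) Γ))
    (hwν : ∀ s ∈ Ioo 0 T, ∀ y ∈ Γ s, IsNormalVelocityAt Γ ν s y (inner ℝ (w s y) (ν s y)))
    {t : ℝ} (ht : t ∈ Ioo 0 T) {y : E3} (hy : y ∈ Γ t) :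
    scalarMaterialDeriv T Γ w (fun s x => ‖v s x‖ ^ 2 / 2) t y =
      inner ℝ (v t y) (materialDeriv T Γ w v t y) := by
  obtain ⟨e, N, D, h, hc, z, hz, rfl⟩ := hΓ.exists_graph_point ht hy
  have hF : ContDiffOn ℝ 1 (Function.uncurry fun s x => ‖v s x‖ ^ 2 / 2)
      (spaceTime (Ioo 0 T) Γ) := (hv.norm_sq ℝ).div_const 2
  have hY := hc.graphDeriv_of_isNormalVelocityAt hΓ hz (hwν t ht _ hy)
  have h1 := hc.fderiv_pullback hF hz (1, planeProj e (w t (graphMap e h (t, z))))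
  have h2 := hc.fderiv_pullback hv hz (1, planeProj e (w t (graphMap e h (t, z))))
  rw [hY] at h1 h2
  rw [scalarMaterialDeriv, materialDeriv]
  refine h1.symm.trans ?_
  have hvd := ((hc.contDiffAt_pullback hv hz).differentiableAt one_ne_zero).hasFDerivAt
  have h3 : HasFDerivAt (graphPullback e h fun s x => ‖v s x‖ ^ 2 / 2) _ (t, z) :=
    hvd.norm_sq.mul_const (2⁻¹ : ℝ)
  rw [h3.fderiv]
  change (2⁻¹ : ℝ) • ((2 : ℕ) • inner ℝ (v t (graphMap e h (t, z)))
    (fderiv ℝ (graphPullback e h v) (t, z) _)) = _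
  rw [h2, nsmul_eq_mul, smul_eq_mul, Nat.cast_ofNat, inv_mul_cancel_left₀ two_ne_zero]

/-- The difference of `(1, w₁)` and `(1, w₂)` is purely spatial and tangential, so a derivative
within the slice `Γ t` remains. -/
theorem scalarMaterialDeriv_sub_scalarMaterialDeriv (hΓ : IsMovingClosedSurface T Γ ν)
    {w₁ w₂ : ℝ → E3 → E3} {q : ℝ → E3 → ℝ}
    (hq : ContDiffOn ℝ 1 (Function.uncurry q) (spaceTime (Ioo 0 T) Γ))
    {t : ℝ} (ht : t ∈ Ioo 0 T) {y : E3} (hy : y ∈ Γ t)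
    (hw : w₁ t y - w₂ t y = tanProj (ν t y) (w₁ t y)) :
    scalarMaterialDeriv T Γ w₁ q t y - scalarMaterialDeriv T Γ w₂ q t y =
      inner ℝ (surfGrad (Γ t) (ν t) (q t) y) (w₁ t y) := by
  obtain ⟨e, N, D, h, hc, z, hz, rfl⟩ := hΓ.exists_graph_point ht hy
  have hn := hΓ.norm_normal t (Ioo_subset_Icc_self ht) _ hy
  have hτ := hc.graphDeriv_of_inner_eq_zero hΓ hz
    (inner_normal_tanProj hn (w₁ t (graphMap e h (t, z))))
  rw [surfGrad, inner_tanProj_comm, inner_gradientWithin_eq, scalarMaterialDeriv,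
    scalarMaterialDeriv, ← map_sub, Prod.mk_sub_mk, sub_self, hw]
  have h1 := hc.fderiv_pullback hq hz
    (0, planeProj e (tanProj (ν t (graphMap e h (t, z))) (w₁ t (graphMap e h (t, z)))))
  have h2 := hc.fderiv_pullback_slice hq hz
    (planeProj e (tanProj (ν t (graphMap e h (t, z))) (w₁ t (graphMap e h (t, z)))))
  rw [hτ] at h1 h2
  exact h1.symm.trans h2

/-- In the product rule the derivative of `V` multiplies `ν`, which is orthogonal to the projected
frame vectors. -/
theorem surfDiv_smul_normal (hΓ : IsMovingClosedSurface T Γ ν) {V : ℝ → E3 → ℝ}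
    (hV : ContDiffOn ℝ 1 (Function.uncurry V) (spaceTime (Ioo 0 T) Γ))
    {t : ℝ} (ht : t ∈ Ioo 0 T) {y : E3} (hy : y ∈ Γ t) :
    surfDiv (Γ t) (ν t) (fun x => V t x • ν t x) y = -(V t y * meanCurv (Γ t) (ν t) y) := by
  obtain ⟨e, N, D, h, hc, z, hz, rfl⟩ := hΓ.exists_graph_point ht hy
  have hn := hΓ.norm_normal t (Ioo_subset_Icc_self ht) _ hy
  have hν := hΓ.contDiffOn_normal
  have h1 := hc.surfDiv_eq hΓ (w := fun s x => V s x • ν s x) (hV.smul hν) hz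
  have h2 := hc.surfDiv_eq hΓ hν hz
  have hVd := ((hc.contDiffAt_pullback hV hz).differentiableAt one_ne_zero).hasFDerivAt
  have hνd := ((hc.contDiffAt_pullback hν hz).differentiableAt one_ne_zero).hasFDerivAt
  have h3 : HasFDerivAt (graphPullback e h fun s x => V s x • ν s x) _ (t, z) := hVd.smul hνd
  rw [meanCurv, mul_neg, neg_neg]
  refine h1.trans ?_
  refine Eq.trans ?_ (congrArg (fun r => V t (graphMap e h (t, z)) * r) h2.symm)
  rw [Finset.mul_sum]
  refine Finset.sum_congr rfl fun k _ => ?_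
  rw [h3.fderiv]
  change inner ℝ (V t (graphMap e h (t, z)) • fderiv ℝ (graphPullback e h ν) (t, z) (planeDir k) +
    fderiv ℝ (graphPullback e h V) (t, z) (planeDir k) • ν t (graphMap e h (t, z))) _ = _
  rw [inner_add_left, inner_smul_left, inner_smul_left, inner_normal_tanProj hn, mul_zero, add_zero]
  rfl

end transport

/-! ### The energy identity -/

theorem lemma5p2 (T : ℝ) (Γ : ℝ → Set E3) (ν : ℝ → E3 → E3)
    (hΓ : IsMovingClosedSurface T Γ ν)
    (V : ℝ → E3 → ℝ)
    (hV : ∀ t ∈ Ioo 0 T, ∀ y ∈ Γ t, IsNormalVelocityAt Γ ν t y (V t y))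
    (v : ℝ → E3 → E3) (q q₁ : ℝ → E3 → ℝ)
    (hv : ContDiffOn ℝ 1 (Function.uncurry v) (spaceTime (Ioo 0 T) Γ))
    (hq : ContDiffOn ℝ 1 (Function.uncurry q) (spaceTime (Ioo 0 T) Γ))
    (hmomentum : ∀ t ∈ Ioo 0 T, ∀ y ∈ Γ t,
      materialDeriv T Γ v v t y + surfGrad (Γ t) (ν t) (q t) y + q₁ t y • ν t y = 0)
    (hcontinuity : ∀ t ∈ Ioo 0 T, ∀ y ∈ Γ t, surfDiv (Γ t) (ν t) (v t) y = 0)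
    (hnormal : ∀ t ∈ Ioo 0 T, ∀ y ∈ Γ t, inner ℝ (v t y) (ν t y) = V t y) :
    ∀ t ∈ Ioo 0 T,
      IntegrableOn (fun y => ‖v t y‖ ^ 2 / 2) (Γ t) μHE[2] ∧
      IntegrableOn (fun y => (q t y * meanCurv (Γ t) (ν t) y - q₁ t y) * V t y) (Γ t) μHE[2] ∧
      HasDerivAt (fun s => ∫ y in Γ s, ‖v s y‖ ^ 2 / 2 ∂μHE[2])
        (∫ y in Γ t, (q t y * meanCurv (Γ t) (ν t) y - q₁ t y) * V t y ∂μHE[2]) t := by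
  intro t ht
  have hν := hΓ.contDiffOn_normal
  have hn : ∀ s ∈ Ioo 0 T, ∀ y ∈ Γ s, ‖ν s y‖ = 1 := fun s hs =>
    hΓ.norm_normal s (Ioo_subset_Icc_self hs)
  set Vn : ℝ → E3 → ℝ := fun s y => inner ℝ (v s y) (ν s y)
  have hVn : ContDiffOn ℝ 1 (Function.uncurry Vn) (spaceTime (Ioo 0 T) Γ) := hv.inner ℝ hν
  -- The normal part of `v` is a second admissible velocity for the same moving surface.
  set w : ℝ → E3 → E3 := fun s y => Vn s y • ν s y
  have hw : ContDiffOn ℝ 1 (Function.uncurry w) (spaceTime (Ioo 0 T) Γ) := hVn.smul hν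
  have hvν : ∀ s ∈ Ioo 0 T, ∀ y ∈ Γ s, IsNormalVelocityAt Γ ν s y (inner ℝ (v s y) (ν s y)) := by
    intro s hs y hy
    rw [hnormal s hs y hy]
    exact hV s hs y hy
  have hwν : ∀ s ∈ Ioo 0 T, ∀ y ∈ Γ s, IsNormalVelocityAt Γ ν s y (inner ℝ (w s y) (ν s y)) := by
    intro s hs y hy
    have : (inner ℝ (w s y) (ν s y) : ℝ) = inner ℝ (v s y) (ν s y) := by
      simp [w, Vn, inner_smul_left, hn s hs y hy]
    rw [this]
    exact hvν s hs y hy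
  have hF : ContDiffOn ℝ 1 (Function.uncurry fun s x => ‖v s x‖ ^ 2 / 2)
      (spaceTime (Ioo 0 T) Γ) := (hv.norm_sq ℝ).div_const 2
  obtain ⟨hi, hi₁, hd₁⟩ := hΓ.hasDerivAt_setIntegral hF hv hvν ht
  obtain ⟨-, hi₂, hd₂⟩ := hΓ.hasDerivAt_setIntegral hq hv hvν ht
  obtain ⟨-, hi₃, hd₃⟩ := hΓ.hasDerivAt_setIntegral hq hw hwν ht
  have hΓm : MeasurableSet (Γ t) := (hΓ.isCompact_slice (Ioo_subset_Icc_self ht)).measurableSet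
  -- The transport integrand of |v|²/2, plus the difference of the two transport integrands of `q`.
  -- All three are integrable, which gives integrability of the right side although `q₁` has no
  -- assumed regularity.
  have hpt : ∀ y ∈ Γ t,
      (scalarMaterialDeriv T Γ v (fun s x => ‖v s x‖ ^ 2 / 2) t y +
          ‖v t y‖ ^ 2 / 2 * surfDiv (Γ t) (ν t) (v t) y) +
        ((scalarMaterialDeriv T Γ v q t y + q t y * surfDiv (Γ t) (ν t) (v t) y) -
          (scalarMaterialDeriv T Γ w q t y + q t y * surfDiv (Γ t) (ν t) (w t) y)) =
      (q t y * meanCurv (Γ t) (ν t) y - q₁ t y) * V t y := by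
    intro y hy
    have h1 := scalarMaterialDeriv_half_norm_sq hΓ hv hvν ht hy
    have h2 := scalarMaterialDeriv_sub_scalarMaterialDeriv hΓ (w₁ := v) (w₂ := w) hq ht hy
      (by simp [w, Vn, tanProj, real_inner_comm])
    have h3 : surfDiv (Γ t) (ν t) (w t) y = _ := surfDiv_smul_normal hΓ hVn ht hy
    have h4 := congrArg (fun x => (inner ℝ (v t y) x : ℝ)) (hmomentum t ht y hy)
    simp only [inner_add_right, inner_smul_right, inner_zero_right] at h4
    have h5 : Vn t y = V t y := hnormal t ht y hy
    rw [hnormal t ht y hy] at h4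
    rw [real_inner_comm] at h2
    rw [h3, h5, hcontinuity t ht y hy, h1]
    linear_combination h4 + h2
  refine ⟨hi, ?_, ?_⟩
  · exact (integrableOn_congr_fun hpt hΓm).1 (hi₁.add (hi₂.sub hi₃))
  · have hzero := integral_sub hi₂ hi₃
    -- Uniqueness of the derivative of ∫ q replaces the divergence theorem on Γ.
    rw [hd₂.unique hd₃, sub_self] at hzero
    have hsplit := integral_add hi₁ (hi₂.sub hi₃)
    simp only [Pi.sub_apply] at hsplit
    rw [← setIntegral_congr_fun hΓm hpt, hsplit, hzero, add_zero]
    exact hd₁
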